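/- Let $n\ge 1$ and let $M=(\mu_1,\dots,\mu_n)$ have strictly positive integer components; put $\mu_*=\min_j\mu_j$, $\langle\xi\rangle_M=\bigl(1+\sum_{j=1}^n|\xi_j|^{2\mu_j}\bigr)^{1/2}$ for $\xi\in\mathbb R^n$, and $\langle\alpha,1/M\rangle=\sum_{j=1}^n\alpha_j/\mu_j$ for $\alpha\in\mathbb Z_+^n$. The Fourier transform is $\hat u(\xi)=\int e^{-ix\cdot\xi}u(x)\,dx$ on $\mathcal S(\mathbb R^n)$, extended to $\mathcal S'(\mathbb R^n)$ by $\langle\hat u,\varphi\rangle=\langle u,\hat\varphi\rangle$. For $s\in\mathbb R$ and $p\in[1,\infty]$, $\mathcal FL^p_{s,M}$ is the space of all $u\in\mathcal S'(\mathbb R^n)$ such that $\hat u$ is a measurable function with $\langle\cdot\rangle_M^s\hat u\in L^p(\mathbb R^n)$, with norm $\|u\|_{\mathcal FL^p_{s,M}}=\|\langle\cdot\rangle_M^s\hat u\|_{L^p}$. For $m\in\mathbb R$, $\delta\in[0,1]$ and $\kappa>0$, $S^m_{M,\delta,\kappa}$ is the class of all $a\in C^\infty(\mathbb R^{2n})$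 such that for all $\alpha,\beta\in\mathbb Z^n_+$ there is a constant $C_{\alpha,\beta}>0$ with, for all $x,\xi\in\mathbb R^n$, $$|\partial_\xi^\alpha\partial_x^\beta a(x,\xi)|\le C_{\alpha,\beta}\langle\xi\rangle_M^{m-\langle\alpha,1/M\rangle+\delta(\langle\beta,1/M\rangle-\kappa)_+}\quad\text{if }\langle\beta,1/M\rangle\ne\kappa,$$ $$|\partial_\xi^\alpha\partial_x^\beta a(x,\xi)|\le C_{\alpha,\beta}\langle\xi\rangle_M^{m-\langle\alpha,1/M\rangle}\log\bigl(1+\langle\xi\rangle_M^{\delta}\bigr)\quad\text{if }\langle\beta,1/M\rangle=\kappa,$$ where $t_+=\max\{t,0\}$. Theorem. Let $m\in\mathbb R$, $\delta\in[0,1]$ and $\kappa>[n/\mu_*]+1$, where $[\cdot]$ is the integer part. Let $a\in S^m_{M,\delta,\kappa}$, and assume that there is a compact set $\mathcal K\subset\mathbb R^n$ with $\operatorname{supp}a(\cdot,\xi)\subseteq\mathcal K$ for every $\xi\in\mathbb R^n$. Then for every $p\in[1,\infty]$ the pseudodifferential operator $$a(x,D)u(x)=(2\pi)^{-n}\int e^{ix\cdot\xi}a(x,\xi)\hat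 u(\xi)\,d\xi,\qquad u\in\mathcal S(\mathbb R^n),$$ regarded as a map $\mathcal S(\mathbb R^n)\to\mathcal S'(\mathbb R^n)$, extends to a bounded linear operator $$a(x,D):\mathcal FL^p_{s+m,M}\to\mathcal FL^p_{s,M}$$ for all $s\in\mathbb R$ if $0\le\delta<1$, and for all $s>0$ if $\delta=1$. -/

import Mathlib

open MeasureTheory SchwartzMap
open scoped ENNReal NNReal ContDiff FourierTransform

noncomputable section

namespace FourierLebesgue

/-- The Euclidean space `ℝⁿ`. -/
abbrev Rn (n : ℕ) : Type := EuclideanSpace ℝ (Fin n)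

/-- The `M`-weight `⟨ξ⟩_M = (1 + ∑ⱼ |ξⱼ| ^ (2 μⱼ)) ^ (1/2)`, for `M = (μ₁, …, μₙ)`. -/
def weight {n : ℕ} (M : Fin n → ℕ) (ξ : Rn n) : ℝ :=
  Real.sqrt (1 + ∑ j, |ξ j| ^ (2 * M j))

/-- The `M`-order `⟨α, 1/M⟩ = ∑ⱼ αⱼ / μⱼ` of a multi-index `α`. -/
def mOrder {n : ℕ} (M α : Fin n → ℕ) : ℝ := ∑ j, (α j : ℝ) / (M j : ℝ)

/-- The minimum order `μ_* = minⱼ μⱼ`. -/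
def minOrder {n : ℕ} (M : Fin n → ℕ) : ℕ := ⨅ j, M j

/-! ### Symbols -/

/-- The derivative of `f` in the direction `v`. -/
def dirDeriv {V : Type*} [NormedAddCommGroup V] [NormedSpace ℝ V] (v : V) (f : V → ℂ) : V → ℂ :=
  fun z => fderiv ℝ f z v

/-- `∂_{e₁}^{α₁} ⋯ ∂_{eₙ}^{αₙ} f`, for a family of directions `e` and a multi-index `α`. -/
def multiDeriv {V : Type*} [NormedAddCommGroup V] [NormedSpace ℝ V] {n : ℕ}
    (e : Fin n → V) (α : Fin n → ℕ) (f : V → ℂ) : V → ℂ :=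
  (List.finRange n).foldr (fun j g => (dirDeriv (e j))^[α j] g) f

/-- The `x`-derivative `∂_x^β` of a function of `(x, ξ) ∈ ℝⁿ × ℝⁿ`. -/
def derivX {n : ℕ} (β : Fin n → ℕ) (a : Rn n × Rn n → ℂ) : Rn n × Rn n → ℂ :=
  multiDeriv (fun j => ((EuclideanSpace.single j (1 : ℝ), 0) : Rn n × Rn n)) β a

/-- The `ξ`-derivative `∂_ξ^α` of a function of `(x, ξ) ∈ ℝⁿ × ℝⁿ`. -/
def derivXi {n : ℕ} (α : Fin n → ℕ) (a : Rn n × Rn n → ℂ) : Rn n × Rn n → ℂ :=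
  multiDeriv (fun j => ((0, EuclideanSpace.single j (1 : ℝ)) : Rn n × Rn n)) α a

/-- The symbol class `S^m_{M,δ,κ}`. -/
structure IsSymbol {n : ℕ} (M : Fin n → ℕ) (m δ κ : ℝ) (a : Rn n × Rn n → ℂ) : Prop where
  smooth : ContDiff ℝ ∞ a
  bound_of_ne : ∀ α β : Fin n → ℕ, mOrder M β ≠ κ → ∃ C : ℝ, 0 < C ∧ ∀ x ξ : Rn n,
    ‖derivXi α (derivX β a) (x, ξ)‖ ≤
      C * weight M ξ ^ (m - mOrder M α + δ * max (mOrder M β - κ) 0)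
  bound_of_eq : ∀ α β : Fin n → ℕ, mOrder M β = κ → ∃ C : ℝ, 0 < C ∧ ∀ x ξ : Rn n,
    ‖derivXi α (derivX β a) (x, ξ)‖ ≤
      C * (weight M ξ ^ (m - mOrder M α) * Real.log (1 + weight M ξ ^ δ))

/-- The `x`-support of the symbol lies in a fixed compact set. -/
def IsLocalized {n : ℕ} (a : Rn n × Rn n → ℂ) : Prop :=
  ∃ K : Set (Rn n), IsCompact K ∧ ∀ ξ : Rn n, tsupport (fun x => a (x, ξ)) ⊆ K

/-! ### The Fourier transform with kernel `exp (-i x·ξ)` -/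

/-- The dilation `ξ ↦ (2π)⁻¹ ξ` of `ℝⁿ`. -/
def dilation (n : ℕ) : Rn n ≃L[ℝ] Rn n :=
  ContinuousLinearEquiv.smulLeft (Units.mk0 (2 * Real.pi)⁻¹ (by positivity))

/-- The Fourier transform `φ̂(ξ) = ∫ exp (-i x·ξ) φ(x) dx` on Schwartz functions, obtained from
Mathlib's one (whose kernel is `exp (-2πi x·ξ)`) by a dilation; see `fourierS_apply`. -/
def fourierS (n : ℕ) : 𝓢(Rn n, ℂ) →L[ℂ] 𝓢(Rn n, ℂ) :=
  (compCLMOfContinuousLinearEquiv ℂ (dilation n)) ∘L (FourierTransform.fourierCLM ℂ 𝓢(Rn n, ℂ))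

theorem fourierS_apply {n : ℕ} (φ : 𝓢(Rn n, ℂ)) (ξ : Rn n) :
    fourierS n φ ξ = ∫ x : Rn n, Complex.exp (-Complex.I * ((∑ j, x j * ξ j : ℝ) : ℂ)) * φ x := by
  have h : ∀ x : Rn n, -(2 * Real.pi * inner ℝ x (dilation n ξ)) = -(∑ j, x j * ξ j) := by
    intro x
    have h2 : (dilation n ξ : Rn n) = (2 * Real.pi)⁻¹ • ξ := rfl
    rw [h2, inner_smul_right, PiLp.inner_apply]
    have h3 : (∑ j, inner ℝ (x j) (ξ j)) = ∑ j, x j * ξ j :=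
      Finset.sum_congr rfl fun j _ => by simp [mul_comm]
    rw [h3]
    field_simp
  change 𝓕 (φ : Rn n → ℂ) (dilation n ξ) = _
  rw [Real.fourier_eq']
  refine integral_congr_ae (Filter.Eventually.of_forall fun x => ?_)
  have h4 : -2 * Real.pi * inner ℝ x (dilation n ξ) = -(∑ j, x j * ξ j) := by
    rw [← h x]; ring
  simp only [smul_eq_mul]
  rw [h4]
  congr 2
  push_cast
  ring

/-- The Fourier transform on tempered distributions, `⟨û, φ⟩ = ⟨u, φ̂⟩`. -/
def fourierD {n : ℕ} (u : 𝓢'(Rn n, ℂ)) : 𝓢'(Rn n, ℂ) :=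
  PointwiseConvergenceCLM.precomp ℂ (fourierS n) u

/-- The tempered distribution `u` is the measurable function `g`. -/
def IsFunction {n : ℕ} (u : 𝓢'(Rn n, ℂ)) (g : Rn n → ℂ) : Prop :=
  AEStronglyMeasurable g volume ∧
    ∀ φ : 𝓢(Rn n, ℂ), Integrable (fun x => g x * φ x) volume ∧ u φ = ∫ x, g x * φ x

/-! ### Fourier-Lebesgue spaces -/

/-- `ξ ↦ ⟨ξ⟩_M ^ s g(ξ)`. -/
def weighted {n : ℕ} (M : Fin n → ℕ) (s : ℝ) (g : Rn n → ℂ) : Rn n → ℂ :=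
  fun ξ => ((weight M ξ ^ s : ℝ) : ℂ) * g ξ

/-- The space `FL^p_{s,M}` of all tempered distributions `u` whose Fourier transform is a measurable
function with `⟨·⟩_M ^ s û ∈ L^p`. -/
def FL {n : ℕ} (M : Fin n → ℕ) (p : ℝ≥0∞) (s : ℝ) : Submodule ℂ 𝓢'(Rn n, ℂ) where
  carrier := {u | ∃ g : Rn n → ℂ, IsFunction (fourierD u) g ∧ MemLp (weighted M s g) p volume}
  add_mem' := by
    rintro u v ⟨g, ⟨hg, hg'⟩, hgp⟩ ⟨h, ⟨hh, hh'⟩, hhp⟩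
    refine ⟨g + h, ⟨hg.add hh, fun φ => ?_⟩, ?_⟩
    · have e : (fun x => (g + h) x * φ x) = fun x => g x * φ x + h x * φ x := by
        funext x; simp [add_mul]
      rw [e, integral_add (hg' φ).1 (hh' φ).1, ← (hg' φ).2, ← (hh' φ).2]
      exact ⟨(hg' φ).1.add (hh' φ).1, rfl⟩
    · have e : weighted M s (g + h) = weighted M s g + weighted M s h := by
        funext x; simp [weighted, mul_add]
      rw [e]
      exact hgp.add hhp
  zero_mem' := by
    refine ⟨0, ⟨aestronglyMeasurable_zero, fun φ => ?_⟩, ?_⟩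
    · have e : (fun x => (0 : Rn n → ℂ) x * φ x) = fun _ => 0 := by funext x; simp
      rw [e]
      exact ⟨integrable_zero _ _ _, by rw [integral_zero]; rfl⟩
    · have e : weighted M s (0 : Rn n → ℂ) = 0 := by funext x; simp [weighted]
      rw [e]
      exact MemLp.zero
  smul_mem' := by
    rintro c u ⟨g, ⟨hg, hg'⟩, hgp⟩
    refine ⟨c • g, ⟨hg.const_smul c, fun φ => ?_⟩, ?_⟩
    · have e : (fun x => (c • g) x * φ x) = fun x => c * (g x * φ x) := by
        funext x; simp [mul_assoc]
      rw [e, integral_const_mul, ← (hg' φ).2]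
      exact ⟨(hg' φ).1.const_mul c, rfl⟩
    · have e : weighted M s (c • g) = c • weighted M s g := by
        funext x; simp [weighted, mul_left_comm]
      rw [e]
      exact hgp.const_smul c

/-- The norm `‖⟨·⟩_M ^ s û‖_{L^p}` of `FL^p_{s,M}` (`∞` when `û` is not a function). The function
that represents `û` is unique up to null sets, so the infimum runs over equal numbers; see
`flNorm_eq`. -/
def flNorm {n : ℕ} (M : Fin n → ℕ) (p : ℝ≥0∞) (s : ℝ) (u : 𝓢'(Rn n, ℂ)) : ℝ≥0∞ :=
  ⨅ (g : Rn n → ℂ) (_ : IsFunction (fourierD u) g), eLpNorm (weighted M s g) p volume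

theorem IsFunction.ae_eq {n : ℕ} {u : 𝓢'(Rn n, ℂ)} {g h : Rn n → ℂ}
    (hg : IsFunction u g) (hh : IsFunction u h) : g =ᵐ[volume] h := by
  have key : ∀ {f : Rn n → ℂ}, IsFunction u f → LocallyIntegrable f volume := by
    intro f hf x
    let b : ContDiffBump x := ⟨1, 2, one_pos, one_lt_two⟩
    have hc : HasCompactSupport (Complex.ofRealCLM ∘ b) := b.hasCompactSupport.comp_left rfl
    have hd : ContDiff ℝ ∞ (Complex.ofRealCLM ∘ b) :=
      Complex.ofRealCLM.contDiff.comp b.contDiff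
    refine ⟨Metric.ball x 1, Metric.ball_mem_nhds x one_pos, ?_⟩
    refine ((hf.2 (hc.toSchwartzMap hd)).1.integrableOn (s := Metric.ball x 1)).congr_fun ?_
      measurableSet_ball
    intro y hy
    have : b y = 1 := b.one_of_mem_closedBall (Metric.ball_subset_closedBall hy)
    simp [this]
  refine ae_eq_of_integral_contDiff_smul_eq (key hg) (key hh) fun w hw hwc => ?_
  have hc : HasCompactSupport (Complex.ofRealCLM ∘ w) := hwc.comp_left rfl
  have hd : ContDiff ℝ ∞ (Complex.ofRealCLM ∘ w) := Complex.ofRealCLM.contDiff.comp hw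
  have h1 := (hg.2 (hc.toSchwartzMap hd)).2
  have h2 := (hh.2 (hc.toSchwartzMap hd)).2
  rw [h1] at h2
  simpa [mul_comm] using h2

theorem flNorm_eq {n : ℕ} (M : Fin n → ℕ) (p : ℝ≥0∞) (s : ℝ) {u : 𝓢'(Rn n, ℂ)} {g : Rn n → ℂ}
    (hg : IsFunction (fourierD u) g) : flNorm M p s u = eLpNorm (weighted M s g) p volume := by
  refine le_antisymm (iInf₂_le g hg) (le_iInf₂ fun h hh => le_of_eq ?_)
  refine eLpNorm_congr_ae ?_
  filter_upwards [hg.ae_eq hh] with ξ hξ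
  simp [weighted, hξ]

/-! ### Pseudodifferential operators -/

/-- `a(x,D)u(x) = (2π)⁻ⁿ ∫ exp (i x·ξ) a(x,ξ) û(ξ) dξ` for a Schwartz function `u`; the integral
converges absolutely for a symbol of polynomial growth in `ξ`. -/
def psdo {n : ℕ} (a : Rn n × Rn n → ℂ) (u : 𝓢(Rn n, ℂ)) (x : Rn n) : ℂ :=
  ((2 * Real.pi : ℝ) : ℂ)⁻¹ ^ n *
    ∫ ξ : Rn n, Complex.exp (Complex.I * ((∑ j, x j * ξ j : ℝ) : ℂ)) * a (x, ξ) * fourierS n u ξ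

/-- `a(x,D)`, defined on Schwartz functions with values in tempered distributions, extends to a
bounded linear operator `FL^p_{t,M} → FL^p_{s,M}`. -/
def ExtendsBoundedly {n : ℕ} (a : Rn n × Rn n → ℂ) (M : Fin n → ℕ) (p : ℝ≥0∞) (t s : ℝ) : Prop :=
  ∃ T : FL M p t →ₗ[ℂ] FL M p s,
    (∃ C : ℝ≥0, ∀ v : FL M p t,
      flNorm M p s (T v : 𝓢'(Rn n, ℂ)) ≤ C * flNorm M p t (v : 𝓢'(Rn n, ℂ))) ∧
    ∀ u : 𝓢(Rn n, ℂ), ∃ hu : toTemperedDistributionCLM (Rn n) ℂ volume u ∈ FL M p t,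
      IsFunction (T ⟨toTemperedDistributionCLM (Rn n) ℂ volume u, hu⟩ : 𝓢'(Rn n, ℂ)) (psdo a u)

end FourierLebesgue

end

/-! On the Fourier side `a(x,D)` is the integral operator with kernel `(2π)⁻ⁿ â(η - ξ, ξ)`, where
`â(ζ, ξ)` is the Fourier transform of `a` in `x` alone (`fourierX`). The symbol is compactly
supported in `x`, so integrating by parts `k μⱼ` times in each `xⱼ` costs pure derivatives of
`M`-order exactly `k` and gives, for every natural `k ≠ κ`, `|â(ζ, ξ)| ≤ C ⟨ξ⟩^(m + δ(k-κ)₊)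
⟨ζ⟩^(-k)` (`IsSymbol.exists_fourierX_bound`). The logarithmic case `k = κ` is never needed.

Take `N = [n/μ_*] + 1 < κ`. Order `N` loses nothing in `ξ`, and `⟨ζ⟩^(-N) ≲ (1+|ζ|)^(-μ_* N)` is
integrable because `μ_* N > n`. It remains to pass the weight `⟨η⟩^s` to `⟨ξ⟩^s`
(`exists_kernel_bound`). By quasi-subadditivity, when `⟨η-ξ⟩` is small against `⟨ξ⟩` the bound of
order `N` suffices. Otherwise a large order `k` is used, and the loss `⟨ξ⟩^(δ(k-κ))` is paid for by
`⟨η-ξ⟩^(-k)`. This works for `s ≥ 0` up to `δ = 1`; for `s < 0` the factor `⟨η⟩^s` is only bounded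
by `1`, and the surplus decay `(1-δ)k` has to compensate, whence `δ < 1`.

The weighted kernel is thus dominated by an integrable convolution kernel, and Young's inequality
(`eLpNorm_lintegral_sub_mul_le`) bounds the operator for all `p ∈ [1, ∞]`. Since Schwartz functions
are not dense for `p = ∞`, the extension is defined by the integral operator acting on `û` itself;
Fubini (`integral_psdo_mul_fourierS`) shows that it agrees with `a(x,D)` on Schwartz functions. -/

namespace FourierLebesgue

variable {n : ℕ} {M : Fin n → ℕ}

/-! ### The weight -/

theorem one_le_weight (ξ : Rn n) : 1 ≤ weight M ξ := by
  rw [weight, Real.one_le_sqrt]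
  have : 0 ≤ ∑ j, |ξ j| ^ (2 * M j) := Finset.sum_nonneg fun j _ => by positivity
  linarith

theorem weight_pos (ξ : Rn n) : 0 < weight M ξ := zero_lt_one.trans_le (one_le_weight ξ)

theorem weight_neg (ξ : Rn n) : weight M (-ξ) = weight M ξ := by simp [weight]

theorem continuous_weight : Continuous (weight M : Rn n → ℝ) := by
  unfold weight
  fun_prop

theorem continuous_weight_rpow (s : ℝ) : Continuous fun ξ : Rn n => weight M ξ ^ s :=
  continuous_weight.rpow_const fun ξ => Or.inl (weight_pos ξ).ne'

theorem abs_pow_le_weight (ξ : Rn n) (j : Fin n) : |ξ j| ^ M j ≤ weight M ξ := by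
  refine Real.le_sqrt_of_sq_le ?_
  rw [← pow_mul, mul_comm]
  have := Finset.single_le_sum (f := fun j => |ξ j| ^ (2 * M j)) (fun j _ => by positivity)
    (Finset.mem_univ j)
  simp only at this
  linarith

theorem weight_le_sum (ξ : Rn n) : weight M ξ ≤ 1 + ∑ j, |ξ j| ^ M j := by
  have h0 : 0 ≤ ∑ j, |ξ j| ^ M j := Finset.sum_nonneg fun j _ => by positivity
  refine Real.sqrt_le_iff.2 ⟨by positivity, ?_⟩
  have h : ∑ j, |ξ j| ^ (2 * M j) ≤ (∑ j, |ξ j| ^ M j) ^ 2 := by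
    have := Finset.sum_sq_le_sq_sum_of_nonneg (s := Finset.univ) (f := fun j => |ξ j| ^ M j)
      (fun j _ => by positivity)
    simpa [← pow_mul, mul_comm] using this
  nlinarith

/-- A power of `1 + ∑ bⱼ` is controlled by the sum of the powers. -/
theorem one_add_sum_pow_le {b : Fin n → ℝ} (hb : ∀ j, 0 ≤ b j) (k : ℕ) :
    (1 + ∑ j, b j) ^ k ≤ (n + 1) ^ k * (1 + ∑ j, b j ^ k) := by
  rcases k with _ | k
  · simp only [pow_zero, one_mul]
    have : (0 : ℝ) ≤ ∑ j : Fin n, (1 : ℝ) := Finset.sum_nonneg fun j _ => zero_le_one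
    linarith
  -- Power mean inequality for `n + 1` numbers: `Option (Fin n)` indexes them, with `none` carrying
  -- the summand `1`.
  have h := pow_sum_div_card_le_sum_pow (s := (Finset.univ : Finset (Option (Fin n))))
    (f := fun o => o.elim 1 b) (by rintro (_ | j) _ <;> simp [hb]) k
  simp only [Fintype.sum_option, Option.elim_none, Option.elim_some, Finset.card_univ,
    Fintype.card_option, Fintype.card_fin, one_pow] at h
  rw [div_le_iff₀ (by positivity)] at h
  refine h.trans ?_
  rw [mul_comm]
  push_cast
  have : (0 : ℝ) ≤ ∑ j, b j ^ (k + 1) := Finset.sum_nonneg fun j _ => pow_nonneg (hb j) _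
  gcongr
  · linarith [(Nat.cast_nonneg n : (0 : ℝ) ≤ n)]
  · omega

theorem weight_pow_le (ξ : Rn n) (k : ℕ) :
    weight M ξ ^ k ≤ (n + 1) ^ k * (1 + ∑ j, |ξ j| ^ (k * M j)) := by
  refine (pow_le_pow_left₀ (weight_pos ξ).le (weight_le_sum ξ) k).trans ?_
  refine (one_add_sum_pow_le (fun j => by positivity) k).trans_eq ?_
  simp [← pow_mul, mul_comm]

/-- The weight is quasi-subadditive. -/
theorem exists_weight_add_le (M : Fin n → ℕ) : ∃ c : ℝ, 1 ≤ c ∧ ∀ ξ η : Rn n,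
    weight M (ξ + η) ≤ c * (weight M ξ + weight M η) := by
  have hs : (0 : ℝ) ≤ ∑ j, 2 ^ M j := Finset.sum_nonneg fun j _ => by positivity
  refine ⟨1 + ∑ j, 2 ^ M j, by linarith, fun ξ η => (weight_le_sum _).trans ?_⟩
  have h : ∀ j, |(ξ + η) j| ^ M j ≤ 2 ^ M j * (weight M ξ + weight M η) := fun j => by
    calc |(ξ + η) j| ^ M j ≤ (|ξ j| + |η j|) ^ M j := by
          gcongr; exact abs_add_le _ _
      _ ≤ 2 ^ (M j - 1) * (|ξ j| ^ M j + |η j| ^ M j) :=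
          add_pow_le (abs_nonneg _) (abs_nonneg _) _
      _ ≤ _ := by
          gcongr
          · norm_num
          · omega
          · exact abs_pow_le_weight _ _
          · exact abs_pow_le_weight _ _
  have h2 := Finset.sum_le_sum fun j (_ : j ∈ Finset.univ) => h j
  rw [← Finset.sum_mul] at h2
  have := one_le_weight (M := M) ξ
  have := one_le_weight (M := M) η
  linarith

/-- The powers of the weight grow at most polynomially. -/
theorem exists_weight_rpow_le (M : Fin n → ℕ) (s : ℝ) : ∃ (N : ℕ) (C : ℝ), 0 ≤ C ∧ ∀ ξ : Rn n,
    weight M ξ ^ s ≤ C * (1 + ‖ξ‖) ^ N := by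
  have hw : ∀ ξ : Rn n, weight M ξ ≤ (1 + n) * (1 + ‖ξ‖) ^ (∑ j, M j) := fun ξ => by
    have h1 : 1 ≤ 1 + ‖ξ‖ := by linarith [norm_nonneg ξ]
    refine (weight_le_sum ξ).trans ?_
    have h : ∀ j ∈ Finset.univ, |ξ j| ^ M j ≤ (1 + ‖ξ‖) ^ (∑ j, M j) := fun j hj => by
      calc |ξ j| ^ M j ≤ (1 + ‖ξ‖) ^ M j := by
            gcongr
            have := PiLp.norm_apply_le ξ j
            rw [Real.norm_eq_abs] at this
            linarith
        _ ≤ _ := pow_le_pow_right₀ h1 (Finset.single_le_sum (fun _ _ => Nat.zero_le _) hj)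
    have h2 := Finset.sum_le_sum h
    simp only [Finset.sum_const, Finset.card_univ, Fintype.card_fin, nsmul_eq_mul] at h2
    have := one_le_pow₀ h1 (n := ∑ j, M j)
    linarith
  refine ⟨(∑ j, M j) * ⌈s⌉₊, (1 + n) ^ ⌈s⌉₊, by positivity, fun ξ => ?_⟩
  calc weight M ξ ^ s ≤ weight M ξ ^ (⌈s⌉₊ : ℝ) :=
        Real.rpow_le_rpow_of_exponent_le (one_le_weight ξ) (Nat.le_ceil s)
    _ = weight M ξ ^ ⌈s⌉₊ := Real.rpow_natCast _ _
    _ ≤ ((1 + n) * (1 + ‖ξ‖) ^ (∑ j, M j)) ^ ⌈s⌉₊ :=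
        pow_le_pow_left₀ (weight_pos ξ).le (hw ξ) _
    _ = _ := by rw [mul_pow, ← pow_mul]

theorem minOrder_le (M : Fin n → ℕ) (j : Fin n) : minOrder M ≤ M j :=
  ciInf_le (OrderBot.bddBelow _) j

theorem minOrder_pos (hn : 1 ≤ n) (hM : ∀ j, 0 < M j) : 0 < minOrder M := by
  have : Nonempty (Fin n) := ⟨⟨0, hn⟩⟩
  exact (le_ciInf fun j => hM j : 1 ≤ ⨅ j, M j)

/-- The weight grows at least like the power of exponent `minOrder M`. -/
theorem exists_pow_minOrder_le (M : Fin n → ℕ) : ∃ C : ℝ, 0 < C ∧ ∀ ξ : Rn n,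
    (1 + ‖ξ‖) ^ minOrder M ≤ C * weight M ξ := by
  refine ⟨(n + 1) ^ minOrder M * (1 + 2 * n), by positivity, fun ξ => ?_⟩
  have h1 : ‖ξ‖ ≤ ∑ j, |ξ j| := by
    rw [EuclideanSpace.norm_eq]
    refine Real.sqrt_le_iff.2 ⟨Finset.sum_nonneg fun j _ => abs_nonneg _, ?_⟩
    simpa using Finset.sum_sq_le_sq_sum_of_nonneg (s := Finset.univ) (f := fun j => |ξ j|)
      (fun j _ => abs_nonneg _)
  have h2 : ∀ j, |ξ j| ^ minOrder M ≤ 2 * weight M ξ := fun j => by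
    have hw := one_le_weight (M := M) ξ
    rcases le_total (|ξ j|) 1 with h | h
    · exact (pow_le_one₀ (abs_nonneg _) h).trans (by linarith)
    · exact ((pow_le_pow_right₀ h (minOrder_le M j)).trans (abs_pow_le_weight ξ j)).trans
        (by linarith)
  calc (1 + ‖ξ‖) ^ minOrder M ≤ (1 + ∑ j, |ξ j|) ^ minOrder M := by gcongr
    _ ≤ (n + 1) ^ minOrder M * (1 + ∑ j, |ξ j| ^ minOrder M) :=
        one_add_sum_pow_le (fun j => abs_nonneg _) _
    _ ≤ (n + 1) ^ minOrder M * ((1 + 2 * n) * weight M ξ) := by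
        gcongr
        have h3 := Finset.sum_le_sum fun j (_ : j ∈ Finset.univ) => h2 j
        simp only [Finset.sum_const, Finset.card_univ, Fintype.card_fin, nsmul_eq_mul] at h3
        linarith [one_le_weight (M := M) ξ]
    _ = _ := by ring

/-! ### The kernel bound -/

/-- A kernel that decays in `ζ = η - ξ` like the Fourier transform in `x` of a symbol acts between
weighted spaces like a convolution kernel. -/
theorem exists_kernel_bound {δ κ m s : ℝ} {N : ℕ} (hδ₁ : δ ≤ 1) (hδ₀ : 0 ≤ δ)
    (hN : (N : ℝ) < κ) (hs : δ < 1 ∨ 0 ≤ s) {A : Rn n → Rn n → ℝ} (hA0 : ∀ ζ ξ, 0 ≤ A ζ ξ)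
    (hA : ∀ k : ℕ, (k : ℝ) ≠ κ → ∃ C : ℝ, 0 ≤ C ∧ ∀ ζ ξ,
      A ζ ξ ≤ C * (weight M ξ ^ (m + δ * max (k - κ) 0) * weight M ζ ^ (-(k : ℝ)))) :
    ∃ C : ℝ, 0 ≤ C ∧ ∀ η ξ,
      weight M η ^ s * A (η - ξ) ξ ≤ C * (weight M (η - ξ) ^ (-(N : ℝ)) * weight M ξ ^ (s + m)) := by
  obtain ⟨c, hc, hadd⟩ := exists_weight_add_le M
  obtain ⟨C₀, hC₀, h₀⟩ := hA N hN.ne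
  -- Since `N < κ`, the positive part vanishes: order `N` costs no power of `weight M ξ`.
  have h₀' : ∀ ζ ξ, A ζ ξ ≤ C₀ * (weight M ξ ^ m * weight M ζ ^ (-(N : ℝ))) := fun ζ ξ => by
    have := h₀ ζ ξ
    rwa [max_eq_right (by linarith), mul_zero, add_zero] at this
  have hbig : ∀ k : ℕ, κ < k → ∃ C : ℝ, 0 ≤ C ∧ ∀ ζ ξ,
      A ζ ξ ≤ C * (weight M ξ ^ (m + δ * (k - κ)) * weight M ζ ^ (-(k : ℝ))) := fun k hk => by
    obtain ⟨C, hC, h⟩ := hA k hk.ne'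
    refine ⟨C, hC, fun ζ ξ => ?_⟩
    have := h ζ ξ
    rwa [max_eq_left (by linarith)] at this
  have hη : ∀ η ξ : Rn n, weight M η ≤ c * (weight M (η - ξ) + weight M ξ) := fun η ξ => by
    simpa using hadd (η - ξ) ξ
  have hξ : ∀ η ξ : Rn n, weight M ξ ≤ c * (weight M (η - ξ) + weight M η) := fun η ξ => by
    have := hadd (-(η - ξ)) η
    rw [weight_neg] at this
    simpa using this
  by_cases hs0 : 0 ≤ s
  -- This choice makes `k - κ - s` positive, so that a power of `Y` can be traded for the same power
  -- of `X` when `Y ≤ X`.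
  · obtain ⟨k, hk⟩ := exists_nat_gt (κ + s)
    obtain ⟨C₁, hC₁, h₁⟩ := hbig k (by linarith)
    refine ⟨(2 * c) ^ s * (C₀ + C₁), by positivity, fun η ξ => ?_⟩
    have hX := weight_pos (M := M) (η - ξ)
    have hY := weight_pos (M := M) ξ
    have hX1 := one_le_weight (M := M) (η - ξ)
    have hY1 := one_le_weight (M := M) ξ
    have hZ := weight_pos (M := M) η
    have hZY := hη η ξ
    specialize h₀' (η - ξ) ξ
    specialize h₁ (η - ξ) ξ
    specialize hA0 (η - ξ) ξ
    set X := weight M (η - ξ)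
    set Y := weight M ξ
    set Z := weight M η
    rcases le_total X Y with hXY | hXY
    · calc Z ^ s * A (η - ξ) ξ ≤ (2 * c * Y) ^ s * (C₀ * (Y ^ m * X ^ (-(N : ℝ)))) := by
            gcongr; nlinarith
        _ = (2 * c) ^ s * C₀ * (X ^ (-(N : ℝ)) * Y ^ (s + m)) := by
            rw [Real.mul_rpow (by positivity) hY.le, Real.rpow_add hY]; ring
        _ ≤ _ := by gcongr; linarith
    -- At `δ = 1` the trade leaves `X ^ (-κ)` in total, still at least as good as `X ^ (-N)`; this
    -- is where `N < κ` enters.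
    · have key : Y ^ (δ * (k - κ) - s) ≤ X ^ (k - s - N : ℝ) := by
        calc Y ^ (δ * (k - κ) - s) ≤ Y ^ (k - κ - s : ℝ) := by
              apply Real.rpow_le_rpow_of_exponent_le hY1
              nlinarith
          _ ≤ X ^ (k - κ - s : ℝ) := Real.rpow_le_rpow hY.le hXY (by linarith)
          _ ≤ _ := Real.rpow_le_rpow_of_exponent_le hX1 (by linarith)
      calc Z ^ s * A (η - ξ) ξ ≤
            (2 * c * X) ^ s * (C₁ * (Y ^ (m + δ * (k - κ)) * X ^ (-(k : ℝ)))) := by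
            gcongr; nlinarith
        _ = (2 * c) ^ s * C₁ * (Y ^ (δ * (k - κ) - s) * (X ^ s * X ^ (-(k : ℝ)) * Y ^ (s + m))) := by
            rw [Real.mul_rpow (by positivity) hX.le,
              show m + δ * (k - κ) = (δ * (k - κ) - s) + (s + m) by ring, Real.rpow_add hY]; ring
        _ ≤ (2 * c) ^ s * C₁ * (X ^ (k - s - N : ℝ) * (X ^ s * X ^ (-(k : ℝ)) * Y ^ (s + m))) := by
            gcongr
        _ = (2 * c) ^ s * C₁ * (X ^ (-(N : ℝ)) * Y ^ (s + m)) := by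
            rw [← mul_assoc (X ^ (k - s - N : ℝ)), ← Real.rpow_add hX, ← Real.rpow_add hX]
            congr 3; ring
        _ ≤ _ := by gcongr; linarith
  · have hδ : δ < 1 := hs.resolve_right hs0
    push Not at hs0
    -- The second bound on `k` says `δ (k - κ) - s < k - N`: the decay of order `k` pays for the
    -- loss in `ξ` and for the missing `Y ^ s`, and still leaves `X ^ (-N)`.
    obtain ⟨k, hk⟩ := exists_nat_gt (max κ ((N - s - δ * κ) / (1 - δ)))
    have hkκ : κ < k := (le_max_left _ _).trans_lt hk
    have hk2 := (le_max_right _ _).trans_lt hk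
    rw [div_lt_iff₀ (by linarith)] at hk2
    obtain ⟨C₁, hC₁, h₁⟩ := hbig k hkκ
    have he : 0 ≤ δ * (k - κ) - s := by
      have := mul_nonneg hδ₀ (sub_nonneg.2 hkκ.le); linarith
    refine ⟨(2 * c) ^ (-s) * C₀ + (2 * c) ^ (δ * (k - κ) - s) * C₁, by positivity, fun η ξ => ?_⟩
    have hX := weight_pos (M := M) (η - ξ)
    have hY := weight_pos (M := M) ξ
    have hX1 := one_le_weight (M := M) (η - ξ)
    have hY1 := one_le_weight (M := M) ξ
    have hZ := weight_pos (M := M) η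
    have hZ1 := one_le_weight (M := M) η
    have hYZ := hξ η ξ
    specialize h₀' (η - ξ) ξ
    specialize h₁ (η - ξ) ξ
    specialize hA0 (η - ξ) ξ
    set X := weight M (η - ξ)
    set Y := weight M ξ
    set Z := weight M η
    have hR : 0 ≤ X ^ (-(N : ℝ)) * Y ^ (s + m) := by positivity
    -- If `2cX ≤ Y`, then `Y ≤ c (X + Z)` absorbs `cX` into `Y / 2` and gives `Z ≥ Y / (2c)`, the
    -- lower bound that a negative power of `Z` requires.
    rcases le_total (2 * c * X) Y with hXY | hXY
    · have hZs : Z ^ s ≤ (2 * c) ^ (-s) * Y ^ s := by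
        have hYZ' : Y * (2 * c)⁻¹ ≤ Z := by
          rw [← div_eq_mul_inv, div_le_iff₀ (by positivity)]; nlinarith
        calc Z ^ s ≤ (Y * (2 * c)⁻¹) ^ s :=
              Real.rpow_le_rpow_of_nonpos (by positivity) hYZ' hs0.le
          _ = _ := by
              rw [Real.mul_rpow hY.le (by positivity), Real.inv_rpow (by positivity),
                Real.rpow_neg (by positivity), mul_comm]
      calc Z ^ s * A (η - ξ) ξ ≤ ((2 * c) ^ (-s) * Y ^ s) * (C₀ * (Y ^ m * X ^ (-(N : ℝ)))) := by
            gcongr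
        _ = (2 * c) ^ (-s) * C₀ * (X ^ (-(N : ℝ)) * Y ^ (s + m)) := by
            rw [Real.rpow_add hY]; ring
        _ ≤ _ := by
            gcongr
            have : 0 ≤ (2 * c) ^ (δ * (k - κ) - s) * C₁ := by positivity
            linarith
    · have key : Y ^ (δ * (k - κ) - s) ≤ (2 * c) ^ (δ * (k - κ) - s) * X ^ (k - N : ℝ) := by
        calc Y ^ (δ * (k - κ) - s) ≤ (2 * c * X) ^ (δ * (k - κ) - s) :=
              Real.rpow_le_rpow hY.le hXY he
          _ = (2 * c) ^ (δ * (k - κ) - s) * X ^ (δ * (k - κ) - s) :=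
              Real.mul_rpow (by positivity) hX.le
          _ ≤ _ := by
              gcongr ?_ * ?_
              exact Real.rpow_le_rpow_of_exponent_le hX1 (by linarith)
      calc Z ^ s * A (η - ξ) ξ ≤ 1 * (C₁ * (Y ^ (m + δ * (k - κ)) * X ^ (-(k : ℝ)))) := by
            gcongr
            exact Real.rpow_le_one_of_one_le_of_nonpos hZ1 hs0.le
        _ = C₁ * (Y ^ (δ * (k - κ) - s) * (X ^ (-(k : ℝ)) * Y ^ (s + m))) := by
            rw [show m + δ * (k - κ) = (δ * (k - κ) - s) + (s + m) by ring, Real.rpow_add hY]; ring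
        _ ≤ C₁ * ((2 * c) ^ (δ * (k - κ) - s) * X ^ (k - N : ℝ) *
              (X ^ (-(k : ℝ)) * Y ^ (s + m))) := by gcongr
        _ = (2 * c) ^ (δ * (k - κ) - s) * C₁ * (X ^ (-(N : ℝ)) * Y ^ (s + m)) := by
            rw [show -(N : ℝ) = (k - N : ℝ) + -(k : ℝ) by ring, Real.rpow_add hX]; ring
        _ ≤ _ := by
            gcongr
            have : 0 ≤ (2 * c) ^ (-s) * C₀ := by positivity
            linarith

/-- The decay of the negative powers of the weight. -/
theorem exists_weight_rpow_neg_le (M : Fin n → ℕ) (N : ℕ) : ∃ C : ℝ, 0 ≤ C ∧ ∀ ξ : Rn n,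
    weight M ξ ^ (-(N : ℝ)) ≤ C * (1 + ‖ξ‖) ^ (-((minOrder M * N : ℕ) : ℝ)) := by
  obtain ⟨C, hC, h⟩ := exists_pow_minOrder_le M
  refine ⟨C ^ N, by positivity, fun ξ => ?_⟩
  have hw := weight_pos (M := M) ξ
  rw [Real.rpow_neg hw.le, Real.rpow_neg (by positivity), Real.rpow_natCast, Real.rpow_natCast,
    ← div_eq_mul_inv, inv_eq_one_div, div_le_div_iff₀ (by positivity) (by positivity), one_mul,
    pow_mul, ← mul_pow]
  exact pow_le_pow_left₀ (by positivity) (h ξ) N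

/-! ### Iterated directional derivatives -/

section Derivatives

variable {V : Type*} [NormedAddCommGroup V] [NormedSpace ℝ V]

theorem contDiff_dirDeriv {f : V → ℂ} (hf : ContDiff ℝ ∞ f) (v : V) :
    ContDiff ℝ ∞ (dirDeriv v f) :=
  (hf.fderiv_right (m := ∞) (by simp)).clm_apply contDiff_const

theorem contDiff_dirDeriv_iterate {f : V → ℂ} (hf : ContDiff ℝ ∞ f) (v : V) (N : ℕ) :
    ContDiff ℝ ∞ ((dirDeriv v)^[N] f) := by
  induction N with
  | zero => exact hf
  | succ N ih =>
    rw [Function.iterate_succ_apply']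
    exact contDiff_dirDeriv ih v

theorem tsupport_dirDeriv_iterate_subset (f : V → ℂ) (v : V) (N : ℕ) :
    tsupport ((dirDeriv v)^[N] f) ⊆ tsupport f := by
  induction N with
  | zero => exact subset_rfl
  | succ N ih =>
    rw [Function.iterate_succ_apply']
    refine subset_trans ?_ ih
    exact tsupport_fderiv_apply_subset ℝ v

/-- Zeroth iterates are the identity, so only the entry `j` acts, and `Nodup` makes it act once. -/
theorem foldr_iterate_single {E : Type*} (D : Fin n → E → E) (j : Fin n) (N : ℕ) (f : E)
    (l : List (Fin n)) (hl : l.Nodup) :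
    l.foldr (fun i g => (D i)^[(Pi.single j N : Fin n → ℕ) i] g) f =
      if j ∈ l then (D j)^[N] f else f := by
  induction l with
  | nil => simp
  | cons i l ih =>
    rw [List.nodup_cons] at hl
    rw [List.foldr_cons, ih hl.2]
    by_cases h : i = j
    · subst h
      simp [hl.1]
    · simp [Ne.symm h]

theorem multiDeriv_single (e : Fin n → V) (j : Fin n) (N : ℕ) (f : V → ℂ) :
    multiDeriv e (Pi.single j N) f = (dirDeriv (e j))^[N] f := by
  rw [multiDeriv, foldr_iterate_single (fun j => dirDeriv (e j)) j N f _ (List.nodup_finRange n)]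
  simp

theorem multiDeriv_zero (e : Fin n → V) (f : V → ℂ) : multiDeriv e 0 f = f := by
  have : ∀ l : List (Fin n),
      l.foldr (fun j g => (dirDeriv (e j))^[(0 : Fin n → ℕ) j] g) f = f := fun l => by
    induction l with
    | nil => rfl
    | cons i l ih => simp
  exact this _

/-- Symbol estimates concern derivatives on the product space, while the integration by parts takes
place in `x` with `ξ` frozen; this identifies the two. -/
theorem dirDeriv_iterate_prodMk_left {W : Type*} [NormedAddCommGroup W] [NormedSpace ℝ W]
    {a : V × W → ℂ} (ha : ContDiff ℝ ∞ a) (v : V) (N : ℕ) (x : V) (w : W) :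
    (dirDeriv ((v, 0) : V × W))^[N] a (x, w) = (dirDeriv v)^[N] (fun y => a (y, w)) x := by
  induction N generalizing x with
  | zero => rfl
  | succ N ih =>
    rw [Function.iterate_succ_apply', Function.iterate_succ_apply', ← funext ih]
    have h := (contDiff_dirDeriv_iterate ha ((v, 0) : V × W) N).differentiable (by simp) (x, w)
    have h2 := h.hasFDerivAt.comp x (hasFDerivAt_prodMk_left (𝕜 := ℝ) x w)
    simp only [dirDeriv]
    erw [h2.fderiv]
    simp

end Derivatives

/-! ### The Fourier transform of a symbol in the space variable -/

/-- The plane wave `x ↦ exp (-i x·ζ)`. -/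
noncomputable def wave (ζ x : Rn n) : ℂ := Complex.exp (-Complex.I * ((∑ j, x j * ζ j : ℝ) : ℂ))

theorem norm_wave (ζ x : Rn n) : ‖wave ζ x‖ = 1 := by
  rw [wave, Complex.norm_exp]
  simp

theorem continuous_wave : Continuous fun z : Rn n × Rn n => wave z.1 z.2 := by
  unfold wave
  fun_prop

theorem hasFDerivAt_phase (ζ x : Rn n) : HasFDerivAt (fun y : Rn n => ∑ j, y j * ζ j)
    (∑ j, ζ j • (EuclideanSpace.proj j : Rn n →L[ℝ] ℝ)) x := by
  refine HasFDerivAt.fun_sum fun j _ => ?_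
  exact (EuclideanSpace.proj j : Rn n →L[ℝ] ℝ).hasFDerivAt.mul_const (ζ j)

theorem contDiff_wave (ζ : Rn n) : ContDiff ℝ ∞ (wave ζ) := by
  unfold wave
  refine ContDiff.cexp (contDiff_const.mul (Complex.ofRealCLM.contDiff.comp ?_))
  have h : ContDiff ℝ ∞ fun x : Rn n => ∑ j, (EuclideanSpace.proj j : Rn n →L[ℝ] ℝ) x * ζ j :=
    ContDiff.sum fun j _ => (EuclideanSpace.proj j : Rn n →L[ℝ] ℝ).contDiff.mul contDiff_const
  exact h

theorem fderiv_wave_single (ζ x : Rn n) (j : Fin n) :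
    fderiv ℝ (wave ζ) x (EuclideanSpace.single j 1) = -(Complex.I * ζ j) * wave ζ x := by
  have h := (((Complex.ofRealCLM.hasFDerivAt.comp x (hasFDerivAt_phase ζ x)).const_mul
    (-Complex.I)).cexp)
  have e : wave ζ = fun y => Complex.exp (-Complex.I *
    (Complex.ofRealCLM ∘ fun y : Rn n => ∑ j, y j * ζ j) y) := rfl
  rw [e, h.fderiv]
  simp [mul_comm]

/-- Integration by parts: the wave is not integrable, but compact support of `f` makes all the
products integrable and removes boundary terms. -/
theorem integral_wave_mul_dirDeriv (ζ : Rn n) (j : Fin n) {f : Rn n → ℂ} (hf : ContDiff ℝ ∞ f)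
    (hc : HasCompactSupport f) :
    ∫ x, wave ζ x * dirDeriv (EuclideanSpace.single j (1 : ℝ)) f x =
      Complex.I * ζ j * ∫ x, wave ζ x * f x := by
  have hw := (contDiff_wave ζ).continuous
  have hd := (contDiff_dirDeriv hf (EuclideanSpace.single j (1 : ℝ))).continuous
  have hdc : HasCompactSupport (dirDeriv (EuclideanSpace.single j (1 : ℝ)) f) :=
    hc.fderiv_apply ℝ _
  have hwf : Integrable (fun x => wave ζ x * f x) :=
    (hw.mul hf.continuous).integrable_of_hasCompactSupport hc.mul_left
  have e : ∀ x, fderiv ℝ (wave ζ) x (EuclideanSpace.single j 1) * f x =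
      -(Complex.I * ζ j) * (wave ζ x * f x) := fun x => by
    rw [fderiv_wave_single, mul_assoc]
  have h := integral_mul_fderiv_eq_neg_fderiv_mul_of_integrable (μ := volume)
    (v := EuclideanSpace.single j (1 : ℝ)) (f := wave ζ) (g := f)
    (by simp only [e]; exact hwf.const_mul _)
    ((hw.mul hd).integrable_of_hasCompactSupport hdc.mul_left) hwf
    (fun x _ => (contDiff_wave ζ).differentiable (by simp) x)
    (fun x _ => hf.differentiable (by simp) x)
  simp only [e, integral_const_mul] at h
  simpa [dirDeriv] using h

theorem integral_wave_mul_dirDeriv_iterate (ζ : Rn n) (j : Fin n) {f : Rn n → ℂ}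
    (hf : ContDiff ℝ ∞ f) (hc : HasCompactSupport f) (N : ℕ) :
    ∫ x, wave ζ x * (dirDeriv (EuclideanSpace.single j (1 : ℝ)))^[N] f x =
      (Complex.I * ζ j) ^ N * ∫ x, wave ζ x * f x := by
  induction N with
  | zero => simp
  | succ N ih =>
    have hc' : HasCompactSupport ((dirDeriv (EuclideanSpace.single j (1 : ℝ)))^[N] f) :=
      hc.of_isClosed_subset (isClosed_tsupport _) (tsupport_dirDeriv_iterate_subset f _ N)
    simp only [Function.iterate_succ_apply']
    rw [integral_wave_mul_dirDeriv ζ j (contDiff_dirDeriv_iterate hf _ N) hc', ih, pow_succ']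
    ring

/-- The Fourier transform in `x` of a function of `(x, ξ)`. -/
noncomputable def fourierX (a : Rn n × Rn n → ℂ) (ζ ξ : Rn n) : ℂ := ∫ x, wave ζ x * a (x, ξ)

theorem stronglyMeasurable_fourierX {a : Rn n × Rn n → ℂ} (ha : Continuous a) :
    StronglyMeasurable fun z : Rn n × Rn n => fourierX a z.1 z.2 := by
  have h : Continuous fun q : (Rn n × Rn n) × Rn n => wave q.1.1 q.2 * a (q.2, q.1.2) := by
    refine Continuous.mul ?_ ?_
    · exact continuous_wave.comp (by fun_prop : Continuous fun q : (Rn n × Rn n) × Rn n =>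
        (q.1.1, q.2))
    · exact ha.comp (by fun_prop)
  exact h.stronglyMeasurable.integral_prod_right

/-- The exponents `k * M j` match the anisotropy: by `weight_pow_le`, the monomials `|ζ j| ^ (k * M
j)` together with `1` control `weight M ζ ^ k`. -/
theorem mOrder_single (hM : ∀ j, 0 < M j) (j : Fin n) (k : ℕ) :
    mOrder M (Pi.single j (k * M j)) = k := by
  have : (M j : ℝ) ≠ 0 := by exact_mod_cast (hM j).ne'
  rw [mOrder, Finset.sum_eq_single j]
  · simp [this]
  · intro i _ hi
    simp [Pi.single_eq_of_ne hi]
  · simp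

theorem mOrder_zero : mOrder M 0 = 0 := by simp [mOrder]

theorem norm_integral_wave_mul_le {K : Set (Rn n)} (hK : IsCompact K) {g : Rn n → ℂ}
    (hg : tsupport g ⊆ K) {B : ℝ} (hB : ∀ x, ‖g x‖ ≤ B) (ζ : Rn n) :
    ‖∫ x, wave ζ x * g x‖ ≤ B * volume.real K := by
  rw [← setIntegral_eq_integral_of_forall_compl_eq_zero (s := K)]
  · refine norm_setIntegral_le_of_norm_le_const hK.measure_lt_top fun x _ => ?_
    rw [norm_mul, norm_wave, one_mul]
    exact hB x
  · intro x hx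
    rw [image_eq_zero_of_notMem_tsupport fun h => hx (hg h), mul_zero]

/-- The decay of the Fourier transform in `x` of a localized symbol. -/
theorem IsSymbol.exists_fourierX_bound (hM : ∀ j, 0 < M j) {m δ κ : ℝ} (hδ : 0 ≤ δ) (hκ : 0 < κ)
    {a : Rn n × Rn n → ℂ} (ha : IsSymbol M m δ κ a) (hloc : IsLocalized a) (k : ℕ)
    (hk : (k : ℝ) ≠ κ) : ∃ C : ℝ, 0 ≤ C ∧ ∀ ζ ξ, ‖fourierX a ζ ξ‖ ≤
      C * (weight M ξ ^ (m + δ * max (k - κ) 0) * weight M ζ ^ (-(k : ℝ))) := by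
  obtain ⟨K, hK, hsupp⟩ := hloc
  have hsm : ∀ ξ, ContDiff ℝ ∞ fun x => a (x, ξ) := fun ξ =>
    ha.smooth.comp (contDiff_id.prodMk contDiff_const)
  have hcs : ∀ ξ, HasCompactSupport fun x => a (x, ξ) := fun ξ =>
    hK.of_isClosed_subset (isClosed_tsupport _) (hsupp ξ)
  obtain ⟨C₀, hC₀, h₀⟩ := ha.bound_of_ne 0 0 (by rw [mOrder_zero]; exact hκ.ne)
  choose C hC h using fun j => ha.bound_of_ne 0 (Pi.single j (k * M j))
    (by rwa [mOrder_single hM])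
  simp only [derivXi, derivX, multiDeriv_zero, multiDeriv_single, mOrder_zero, mOrder_single hM,
    sub_zero, zero_sub] at h₀ h
  rw [max_eq_right (by linarith), mul_zero, add_zero] at h₀
  have hsum : 0 ≤ ∑ j, C j := Finset.sum_nonneg fun j _ => (hC j).le
  refine ⟨(n + 1) ^ k * ((C₀ + ∑ j, C j) * volume.real K), by positivity, fun ζ ξ => ?_⟩
  set W := weight M ξ ^ (m + δ * max (k - κ) 0) with hW
  have b₀ : ‖fourierX a ζ ξ‖ ≤ C₀ * W * volume.real K := by
    refine norm_integral_wave_mul_le hK (hsupp ξ) (fun x => (h₀ x ξ).trans ?_) ζ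
    gcongr
    refine Real.rpow_le_rpow_of_exponent_le (one_le_weight ξ) ?_
    have : 0 ≤ δ * max (k - κ) 0 := by positivity
    linarith
  have b : ∀ j, |ζ j| ^ (k * M j) * ‖fourierX a ζ ξ‖ ≤ C j * W * volume.real K := fun j => by
    have e := integral_wave_mul_dirDeriv_iterate ζ j (hsm ξ) (hcs ξ) (k * M j)
    have e' : |ζ j| ^ (k * M j) * ‖fourierX a ζ ξ‖ =
        ‖∫ x, wave ζ x * (dirDeriv (EuclideanSpace.single j (1 : ℝ)))^[k * M j]
          (fun y => a (y, ξ)) x‖ := by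
      rw [e, norm_mul, norm_pow, norm_mul, Complex.norm_I, one_mul, Complex.norm_real,
        Real.norm_eq_abs, fourierX]
    rw [e']
    refine norm_integral_wave_mul_le hK
      ((tsupport_dirDeriv_iterate_subset _ _ _).trans (hsupp ξ)) (fun x => ?_) ζ
    rw [← dirDeriv_iterate_prodMk_left ha.smooth]
    exact h j x ξ
  have hw := weight_pos (M := M) ζ
  rw [Real.rpow_neg hw.le, Real.rpow_natCast, ← mul_assoc, ← div_eq_mul_inv,
    le_div_iff₀ (by positivity)]
  calc ‖fourierX a ζ ξ‖ * weight M ζ ^ k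
      ≤ ‖fourierX a ζ ξ‖ * ((n + 1) ^ k * (1 + ∑ j, |ζ j| ^ (k * M j))) := by
        gcongr; exact weight_pow_le ζ k
    _ = (n + 1) ^ k * (‖fourierX a ζ ξ‖ + ∑ j, |ζ j| ^ (k * M j) * ‖fourierX a ζ ξ‖) := by
        rw [← Finset.sum_mul]; ring
    _ ≤ (n + 1) ^ k * (C₀ * W * volume.real K + ∑ j, C j * W * volume.real K) := by
        gcongr ?_ * (?_ + ?_)
        exact Finset.sum_le_sum fun j _ => b j
    _ = _ := by
        rw [← Finset.sum_mul, ← Finset.sum_mul]; ring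

/-! ### Young's inequality `L¹ * Lᵖ ⊆ Lᵖ` -/

/-- For fixed `η` the measure `k (η - ξ) dξ` has total mass `∫ k`. Hölder for that measure bounds
the `p`-th power of the integral, and Tonelli in `η` concludes. Working in `ℝ≥0∞` avoids finiteness
assumptions. -/
theorem eLpNorm_lintegral_sub_mul_le {k f : Rn n → ℝ≥0∞} (hk : Measurable k)
    (hf : AEMeasurable f) {p : ℝ≥0∞} (hp : 1 ≤ p) :
    eLpNorm (fun η => ∫⁻ ξ, k (η - ξ) * f ξ) p volume ≤ (∫⁻ ζ, k ζ) * eLpNorm f p volume := by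
  have hkη : ∀ η, Measurable fun ξ => k (η - ξ) := fun η =>
    hk.comp (measurable_const.sub measurable_id)
  have hkI : ∀ η, ∫⁻ ξ, k (η - ξ) = ∫⁻ ζ, k ζ := fun η => lintegral_sub_left_eq_self k η
  set I := ∫⁻ ζ, k ζ with hI
  have hden : ∀ (η : Rn n) {g : Rn n → ℝ≥0∞}, AEMeasurable g →
      ∫⁻ ξ, g ξ ∂(volume.withDensity fun ξ => k (η - ξ)) = ∫⁻ ξ, k (η - ξ) * g ξ := fun η g hg =>
    lintegral_withDensity_eq_lintegral_mul₀ (hkη η).aemeasurable hg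
  have huniv : ∀ η, (volume.withDensity fun ξ => k (η - ξ)) Set.univ = I := fun η => by
    rw [withDensity_apply _ MeasurableSet.univ, Measure.restrict_univ, hkI]
  have hac : ∀ η, (volume.withDensity fun ξ => k (η - ξ)) ≪ (volume : Measure (Rn n)) := fun η =>
    withDensity_absolutelyContinuous _ _
  rcases eq_or_ne p ∞ with rfl | hp'
  · rw [eLpNorm_exponent_top]
    refine essSup_le_of_ae_le _ (Filter.Eventually.of_forall fun η => ?_)
    change ∫⁻ ξ, k (η - ξ) * f ξ ≤ I * eLpNorm f ∞ volume
    calc ∫⁻ ξ, k (η - ξ) * f ξ ≤ ∫⁻ ξ, k (η - ξ) * eLpNorm f ∞ volume := by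
          refine lintegral_mono_ae ?_
          filter_upwards [enorm_ae_le_eLpNormEssSup f volume] with ξ hξ
          gcongr
          simpa using hξ
      _ = I * eLpNorm f ∞ volume := by rw [lintegral_mul_const _ (hkη η), hkI]
  · have hp0 : p ≠ 0 := (zero_lt_one.trans_le hp).ne'
    have hr : 1 ≤ p.toReal := by
      rw [← ENNReal.toReal_one]; exact ENNReal.toReal_mono hp' hp
    have hr0 : 0 < p.toReal := by linarith
    have hpt : ∀ η, (∫⁻ ξ, k (η - ξ) * f ξ) ^ p.toReal ≤
        I ^ (p.toReal - 1) * ∫⁻ ξ, k (η - ξ) * f ξ ^ p.toReal := fun η => by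
      -- Comparison of the `L¹` and `Lᵖ` norms of `f` for the measure of mass `I`.
      have h := eLpNorm_le_eLpNorm_mul_rpow_measure_univ hp
        (hf.mono_ac (hac η)).aestronglyMeasurable
      rw [eLpNorm_one_eq_lintegral_enorm, eLpNorm_eq_lintegral_rpow_enorm_toReal hp0 hp',
        huniv] at h
      simp only [enorm_eq_self, ENNReal.toReal_one, div_one] at h
      rw [hden η hf, hden η (hf.pow_const _)] at h
      calc _ ≤ _ := ENNReal.rpow_le_rpow h hr0.le
        _ = _ := by
          rw [ENNReal.mul_rpow_of_nonneg _ _ hr0.le, ← ENNReal.rpow_mul, ← ENNReal.rpow_mul,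
            one_div_mul_cancel hr0.ne', ENNReal.rpow_one, mul_comm]
          congr 2
          field_simp
    rw [eLpNorm_eq_lintegral_rpow_enorm_toReal hp0 hp',
      eLpNorm_eq_lintegral_rpow_enorm_toReal hp0 hp']
    simp only [enorm_eq_self]
    have hmeas : AEMeasurable (Function.uncurry fun η ξ : Rn n => k (η - ξ) * f ξ ^ p.toReal)
        (volume.prod volume) :=
      (hk.comp measurable_sub).aemeasurable.mul ((hf.pow_const _).comp_snd)
    have hkξ : ∀ ξ, ∫⁻ η, k (η - ξ) = I := fun ξ => lintegral_sub_right_eq_self k ξ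
    calc (∫⁻ η, (∫⁻ ξ, k (η - ξ) * f ξ) ^ p.toReal) ^ (1 / p.toReal)
        ≤ (∫⁻ η, I ^ (p.toReal - 1) * ∫⁻ ξ, k (η - ξ) * f ξ ^ p.toReal) ^ (1 / p.toReal) := by
          gcongr with η; exact hpt η
      _ = (I ^ (p.toReal - 1) * (I * ∫⁻ ξ, f ξ ^ p.toReal)) ^ (1 / p.toReal) := by
          have hη : AEMeasurable fun η => ∫⁻ ξ, k (η - ξ) * f ξ ^ p.toReal :=
            hmeas.lintegral_prod_right'
          rw [lintegral_const_mul'' _ hη, lintegral_lintegral_swap hmeas,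
            ← lintegral_const_mul'' _ (hf.pow_const _)]
          congr 3
          funext ξ
          have hkm : Measurable fun η => k (η - ξ) := hk.comp (measurable_id.sub measurable_const)
          rw [lintegral_mul_const _ hkm, hkξ]
      _ = _ := by
          rw [← mul_assoc]
          nth_rewrite 2 [← ENNReal.rpow_one I]
          rw [← ENNReal.rpow_add_of_nonneg _ _ (by linarith) zero_le_one, sub_add_cancel,
            ENNReal.mul_rpow_of_nonneg _ _ (by positivity), ← ENNReal.rpow_mul,
            mul_one_div_cancel hr0.ne', ENNReal.rpow_one]

/-- As `L * q ≥ L > n`, one exponent serves every `q ≥ 1`, in particular every conjugate exponent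
used in Hölder's inequality. -/
theorem memLp_one_add_norm_rpow_neg {L : ℕ} (hL : n < L) {q : ℝ≥0∞} (hq : 1 ≤ q) :
    MemLp (fun ζ : Rn n => (1 + ‖ζ‖) ^ (-(L : ℝ))) q volume := by
  have hcont : Continuous fun ζ : Rn n => (1 + ‖ζ‖) ^ (-(L : ℝ)) :=
    (continuous_const.add continuous_norm).rpow_const fun ζ =>
      Or.inl (by linarith [norm_nonneg ζ] : (0 : ℝ) < 1 + ‖ζ‖).ne'
  rcases eq_or_ne q ∞ with rfl | hq'
  · refine memLp_top_of_bound hcont.aestronglyMeasurable 1 (Filter.Eventually.of_forall fun ζ => ?_)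
    rw [Real.norm_of_nonneg (by positivity)]
    exact Real.rpow_le_one_of_one_le_of_nonpos (by linarith [norm_nonneg ζ]) (by simp)
  · have hr : 1 ≤ q.toReal := by
      rw [← ENNReal.toReal_one]; exact ENNReal.toReal_mono hq' hq
    rw [← integrable_norm_rpow_iff hcont.aestronglyMeasurable (zero_lt_one.trans_le hq).ne' hq']
    have hL' : (n : ℝ) < L := by exact_mod_cast hL
    have h := integrable_one_add_norm (E := Rn n) (μ := volume) (r := L * q.toReal)
      (by rw [finrank_euclideanSpace_fin]; nlinarith [(Nat.cast_nonneg n : (0 : ℝ) ≤ n)])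
    refine h.congr (Filter.Eventually.of_forall fun ζ => ?_)
    simp only
    rw [Real.norm_of_nonneg (by positivity), ← Real.rpow_mul (by positivity), neg_mul]

/-! ### Integral operators between weighted spaces -/

section IntegralOperator

variable {A : Rn n → Rn n → ℂ} {C s t : ℝ} {L : ℕ} {p : ℝ≥0∞} {g : Rn n → ℂ}

theorem norm_weighted (s : ℝ) (g : Rn n → ℂ) (ξ : Rn n) :
    ‖weighted M s g ξ‖ = weight M ξ ^ s * ‖g ξ‖ := by
  rw [weighted, norm_mul, Complex.norm_real,
    Real.norm_of_nonneg (Real.rpow_nonneg (weight_pos ξ).le _)]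

theorem aestronglyMeasurable_weighted (s : ℝ) (hg : AEStronglyMeasurable g) :
    AEStronglyMeasurable (weighted M s g) :=
  (Complex.continuous_ofReal.comp (continuous_weight_rpow s)).aestronglyMeasurable.mul hg

theorem norm_kernel_mul_le
    (hA : ∀ η ξ, weight M η ^ s * ‖A η ξ‖ ≤ C * ((1 + ‖η - ξ‖) ^ (-(L : ℝ)) * weight M ξ ^ t))
    (g : Rn n → ℂ) (η ξ : Rn n) : weight M η ^ s * ‖A η ξ * g ξ‖ ≤
      C * (1 + ‖η - ξ‖) ^ (-(L : ℝ)) * ‖weighted M t g ξ‖ := by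
  rw [norm_weighted, norm_mul, ← mul_assoc]
  calc _ ≤ C * ((1 + ‖η - ξ‖) ^ (-(L : ℝ)) * weight M ξ ^ t) * ‖g ξ‖ := by
        exact mul_le_mul_of_nonneg_right (hA η ξ) (norm_nonneg _)
    _ = _ := by ring

/-- Hölder: the kernel lies in the conjugate space as a function of `ξ`. Absolute convergence at
every `η` is what makes the Bochner integral additive in `g`. -/
theorem integrable_kernel_mul (hL : n < L) (hp : 1 ≤ p)
    (hAm : StronglyMeasurable fun z : Rn n × Rn n => A z.1 z.2)
    (hA : ∀ η ξ, weight M η ^ s * ‖A η ξ‖ ≤ C * ((1 + ‖η - ξ‖) ^ (-(L : ℝ)) * weight M ξ ^ t))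
    (hg : AEStronglyMeasurable g) (hgp : MemLp (weighted M t g) p) (η : Rn n) :
    Integrable fun ξ => A η ξ * g ξ := by
  have := ENNReal.HolderConjugate.conjExponent hp
  have hq : 1 ≤ p.conjExponent := ENNReal.HolderConjugate.one_le p.conjExponent p
  have hk : MemLp (fun ξ => (1 + ‖η - ξ‖) ^ (-(L : ℝ))) p.conjExponent :=
    (memLp_one_add_norm_rpow_neg hL hq).comp_measurePreserving
      (Measure.measurePreserving_sub_left volume η)
  have hint : Integrable fun ξ => (1 + ‖η - ξ‖) ^ (-(L : ℝ)) * ‖weighted M t g ξ‖ := by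
    have : p.conjExponent.HolderTriple p 1 := ENNReal.HolderTriple.symm
    exact hk.integrable_mul hgp.norm
  refine (hint.const_mul ((weight M η ^ s)⁻¹ * C)).mono' ?_ (Filter.Eventually.of_forall fun ξ => ?_)
  · exact (hAm.comp_measurable measurable_prodMk_left).aestronglyMeasurable.mul hg
  · have hw : 0 < weight M η ^ s := Real.rpow_pos_of_pos (weight_pos η) _
    rw [mul_assoc, inv_mul_eq_div, le_div_iff₀ hw, mul_comm _ (weight M η ^ s), ← mul_assoc]
    exact norm_kernel_mul_le hA g η ξ

theorem aestronglyMeasurable_integral_kernel_mul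
    (hAm : StronglyMeasurable fun z : Rn n × Rn n => A z.1 z.2) (hg : AEStronglyMeasurable g) :
    AEStronglyMeasurable fun η => ∫ ξ, A η ξ * g ξ :=
  (hAm.aestronglyMeasurable.mul hg.comp_snd).integral_prod_right'

theorem eLpNorm_integral_kernel_mul_le (hp : 1 ≤ p)
    (hA : ∀ η ξ, weight M η ^ s * ‖A η ξ‖ ≤ C * ((1 + ‖η - ξ‖) ^ (-(L : ℝ)) * weight M ξ ^ t))
    (hg : AEStronglyMeasurable g) :
    eLpNorm (weighted M s fun η => ∫ ξ, A η ξ * g ξ) p volume ≤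
      (∫⁻ ζ : Rn n, ENNReal.ofReal (C * (1 + ‖ζ‖) ^ (-(L : ℝ)))) *
        eLpNorm (weighted M t g) p volume := by
  have hmk : Measurable fun ζ : Rn n => ENNReal.ofReal (C * (1 + ‖ζ‖) ^ (-(L : ℝ))) := by fun_prop
  have hmg := (aestronglyMeasurable_weighted (M := M) t hg).enorm
  have hY := eLpNorm_lintegral_sub_mul_le hmk hmg hp
  rw [eLpNorm_enorm] at hY
  refine le_trans (eLpNorm_mono_enorm fun η => ?_) hY
  rw [enorm_eq_self]
  have hw : 0 ≤ weight M η ^ s := Real.rpow_nonneg (weight_pos η).le _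
  calc ‖weighted M s (fun η => ∫ ξ, A η ξ * g ξ) η‖ₑ
      = ‖∫ ξ, ((weight M η ^ s : ℝ) : ℂ) * (A η ξ * g ξ)‖ₑ := by
        rw [integral_const_mul]; rfl
    _ ≤ ∫⁻ ξ, ‖((weight M η ^ s : ℝ) : ℂ) * (A η ξ * g ξ)‖ₑ := enorm_integral_le_lintegral_enorm _
    _ ≤ _ := by
        refine lintegral_mono fun ξ => ?_
        rw [← ofReal_norm, ← ofReal_norm (weighted M t g ξ),
          ← ENNReal.ofReal_mul' (norm_nonneg _)]
        refine ENNReal.ofReal_le_ofReal ?_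
        rw [norm_mul, Complex.norm_real, Real.norm_of_nonneg hw]
        exact norm_kernel_mul_le hA g η ξ

end IntegralOperator

/-! ### Functions as tempered distributions -/

theorem IsFunction.add {u v : 𝓢'(Rn n, ℂ)} {g h : Rn n → ℂ} (hg : IsFunction u g)
    (hh : IsFunction v h) : IsFunction (u + v) (g + h) := by
  refine ⟨hg.1.add hh.1, fun φ => ?_⟩
  have e : (fun x => (g + h) x * φ x) = fun x => g x * φ x + h x * φ x := by
    funext x; simp [add_mul]
  rw [e, integral_add (hg.2 φ).1 (hh.2 φ).1, ← (hg.2 φ).2, ← (hh.2 φ).2]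
  exact ⟨(hg.2 φ).1.add (hh.2 φ).1, rfl⟩

theorem IsFunction.const_smul {u : 𝓢'(Rn n, ℂ)} {g : Rn n → ℂ} (hg : IsFunction u g) (c : ℂ) :
    IsFunction (c • u) (c • g) := by
  refine ⟨hg.1.const_smul c, fun φ => ?_⟩
  have e : (fun x => (c • g) x * φ x) = fun x => c * (g x * φ x) := by
    funext x; simp [mul_assoc]
  rw [e, integral_const_mul, ← (hg.2 φ).2]
  exact ⟨(hg.2 φ).1.const_mul c, rfl⟩

theorem IsFunction.unique {u v : 𝓢'(Rn n, ℂ)} {g : Rn n → ℂ} (hu : IsFunction u g)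
    (hv : IsFunction v g) : u = v := by
  ext φ
  rw [(hu.2 φ).2, (hv.2 φ).2]

theorem one_add_norm_pow_mul_le_seminorm (φ : 𝓢(Rn n, ℂ)) (k : ℕ) (x : Rn n) :
    (1 + ‖x‖) ^ k * ‖φ x‖ ≤
      2 ^ k * (Finset.Iic (k, 0)).sup (schwartzSeminormFamily ℂ (Rn n) ℂ) φ := by
  have h := one_add_le_sup_seminorm_apply (𝕜 := ℂ) (m := (k, 0)) le_rfl le_rfl φ x
  rwa [norm_iteratedFDeriv_zero] at h

/-- A measurable function in a weighted `Lᵖ` space is a tempered distribution. -/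
theorem exists_isFunction {h : Rn n → ℂ} {p : ℝ≥0∞} (hp : 1 ≤ p) {s : ℝ}
    (hm : AEStronglyMeasurable h) (hh : MemLp (weighted M s h) p) :
    ∃ H : 𝓢'(Rn n, ℂ), IsFunction H h := by
  obtain ⟨N, C, hC, hw⟩ := exists_weight_rpow_le M (-s)
  have := ENNReal.HolderConjugate.conjExponent hp
  have hq : 1 ≤ p.conjExponent := ENNReal.HolderConjugate.one_le p.conjExponent p
  have hint : Integrable fun ξ : Rn n =>
      (1 + ‖ξ‖) ^ (-((n + 1 : ℕ) : ℝ)) * ‖weighted M s h ξ‖ := by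
    have : p.conjExponent.HolderTriple p 1 := ENNReal.HolderTriple.symm
    exact (memLp_one_add_norm_rpow_neg (Nat.lt_succ_self n) hq).integrable_mul hh.norm
  -- The decay of `φ` is split: `N` powers absorb `weight ^ (-s)`, the other `n + 1` give a function
  -- in the conjugate Lebesgue space.
  set k := N + (n + 1) with hk
  set S : 𝓢(Rn n, ℂ) → ℝ := fun φ =>
    2 ^ k * (Finset.Iic (k, 0)).sup (schwartzSeminormFamily ℂ (Rn n) ℂ) φ with hS
  have hb : ∀ (φ : 𝓢(Rn n, ℂ)) (ξ : Rn n), ‖h ξ * φ ξ‖ ≤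
      C * S φ * ((1 + ‖ξ‖) ^ (-((n + 1 : ℕ) : ℝ)) * ‖weighted M s h ξ‖) := fun φ ξ => by
    have hwp := weight_pos (M := M) ξ
    have h1 : (1 + ‖ξ‖) ^ N * ‖φ ξ‖ ≤ S φ * (1 + ‖ξ‖) ^ (-((n + 1 : ℕ) : ℝ)) := by
      have := one_add_norm_pow_mul_le_seminorm φ k ξ
      rw [Real.rpow_neg (by positivity), Real.rpow_natCast, ← div_eq_mul_inv,
        le_div_iff₀ (by positivity)]
      refine le_trans (le_of_eq ?_) this
      rw [hk, pow_add]; ring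
    calc ‖h ξ * φ ξ‖ = weight M ξ ^ (-s) * ‖φ ξ‖ * ‖weighted M s h ξ‖ := by
          rw [norm_weighted, norm_mul, Real.rpow_neg hwp.le]
          have := (Real.rpow_pos_of_pos hwp s).ne'
          field_simp
      _ ≤ C * (1 + ‖ξ‖) ^ N * ‖φ ξ‖ * ‖weighted M s h ξ‖ := by gcongr; exact hw ξ
      _ = C * ((1 + ‖ξ‖) ^ N * ‖φ ξ‖) * ‖weighted M s h ξ‖ := by ring
      _ ≤ C * (S φ * (1 + ‖ξ‖) ^ (-((n + 1 : ℕ) : ℝ))) * ‖weighted M s h ξ‖ := by gcongr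
      _ = _ := by ring
  have hi : ∀ φ : 𝓢(Rn n, ℂ), Integrable fun ξ => h ξ * φ ξ := fun φ =>
    (hint.const_mul (C * S φ)).mono' (hm.mul φ.continuous.aestronglyMeasurable)
      (Filter.Eventually.of_forall (hb φ))
  let H : 𝓢(Rn n, ℂ) →L[ℂ] ℂ := mkCLMtoNormedSpace (fun φ => ∫ ξ, h ξ * φ ξ)
    (fun φ ψ => by
      rw [← integral_add (hi φ) (hi ψ)]
      simp [mul_add])
    (fun c φ => by
      rw [RingHom.id_apply, ← integral_smul]
      simp [mul_left_comm])
    (by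
      refine ⟨Finset.Iic (k, 0), C * 2 ^ k *
        ∫ ξ : Rn n, (1 + ‖ξ‖) ^ (-((n + 1 : ℕ) : ℝ)) * ‖weighted M s h ξ‖, ?_, fun φ => ?_⟩
      · have : 0 ≤ ∫ ξ : Rn n, (1 + ‖ξ‖) ^ (-((n + 1 : ℕ) : ℝ)) * ‖weighted M s h ξ‖ :=
          integral_nonneg fun ξ => by positivity
        positivity
      · refine (norm_integral_le_of_norm_le (hint.const_mul (C * S φ))
          (Filter.Eventually.of_forall (hb φ))).trans_eq ?_
        rw [integral_const_mul, hS]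
        ring)
  exact ⟨ContinuousLinearMap.toPointwiseConvergenceCLM _ _ _ _ H, hm, fun φ => ⟨hi φ, rfl⟩⟩

/-! ### Fourier inversion -/

/-- The inverse of `fourierS`. -/
noncomputable def fourierInvS (n : ℕ) : 𝓢(Rn n, ℂ) →L[ℂ] 𝓢(Rn n, ℂ) :=
  (FourierTransform.fourierInvCLM ℂ 𝓢(Rn n, ℂ)) ∘L
    (compCLMOfContinuousLinearEquiv ℂ (dilation n).symm)

theorem fourierS_fourierInvS (φ : 𝓢(Rn n, ℂ)) : fourierS n (fourierInvS n φ) = φ := by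
  ext x
  simp [fourierS, fourierInvS]

theorem fourierInvS_fourierS (φ : 𝓢(Rn n, ℂ)) : fourierInvS n (fourierS n φ) = φ := by
  have : compCLMOfContinuousLinearEquiv ℂ (dilation n).symm
      (compCLMOfContinuousLinearEquiv ℂ (dilation n) (𝓕 φ)) = 𝓕 φ := by
    ext x
    simp
  simp only [fourierS, fourierInvS, ContinuousLinearMap.comp_apply,
    FourierTransform.fourierCLM_apply, FourierTransform.fourierInvCLM_apply, this]
  simp

/-- The inverse of `fourierD`. -/
noncomputable def fourierInvD (u : 𝓢'(Rn n, ℂ)) : 𝓢'(Rn n, ℂ) :=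
  PointwiseConvergenceCLM.precomp ℂ (fourierInvS n) u

theorem fourierInvD_apply (u : 𝓢'(Rn n, ℂ)) (φ : 𝓢(Rn n, ℂ)) :
    fourierInvD u φ = u (fourierInvS n φ) := rfl

theorem fourierD_fourierInvD (u : 𝓢'(Rn n, ℂ)) : fourierD (fourierInvD u) = u := by
  ext φ
  change u (fourierInvS n (fourierS n φ)) = u φ
  rw [fourierInvS_fourierS]

/-! ### Schwartz functions -/

theorem fourierS_eq_integral_wave (φ : 𝓢(Rn n, ℂ)) (ξ : Rn n) :
    fourierS n φ ξ = ∫ x, wave ξ x * φ x := fourierS_apply φ ξ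

theorem wave_comm (ζ x : Rn n) : wave ζ x = wave x ζ := by
  simp only [wave, mul_comm]

theorem wave_mul_wave_neg (η ξ x : Rn n) : wave η x * wave (-ξ) x = wave (η - ξ) x := by
  rw [wave, wave, wave, ← Complex.exp_add, ← mul_add, ← Complex.ofReal_add,
    ← Finset.sum_add_distrib]
  congr 4
  funext j
  simp only [PiLp.neg_apply, PiLp.sub_apply]
  ring

/-- Fubini and the symmetry of the kernel. It makes the distributional transform of a Schwartz
function agree with the classical one. -/
theorem integral_fourierS_mul (φ ψ : 𝓢(Rn n, ℂ)) :
    ∫ x, fourierS n φ x * ψ x = ∫ ξ, fourierS n ψ ξ * φ ξ := by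
  simp only [fourierS_eq_integral_wave, ← integral_mul_const]
  rw [integral_integral_swap]
  · refine integral_congr_ae (Filter.Eventually.of_forall fun y =>
      integral_congr_ae (Filter.Eventually.of_forall fun x => ?_))
    simp only
    rw [wave_comm]
    ring
  · refine (ψ.integrable.mul_prod φ.integrable).mono
      (Continuous.aestronglyMeasurable ?_) (Filter.Eventually.of_forall fun z => ?_)
    · exact (continuous_wave.mul (φ.continuous.comp continuous_snd)).mul
        (ψ.continuous.comp continuous_fst)
    · simp only [Function.uncurry, norm_mul, norm_wave, one_mul]
      rw [mul_comm]

theorem isFunction_fourierD_toTemperedDistributionCLM (u : 𝓢(Rn n, ℂ)) :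
    IsFunction (fourierD (toTemperedDistributionCLM (Rn n) ℂ volume u)) (fourierS n u) := by
  refine ⟨(fourierS n u).continuous.aestronglyMeasurable, fun φ => ⟨?_, ?_⟩⟩
  · exact φ.integrable.bdd_mul (fourierS n u).continuous.aestronglyMeasurable
      (Filter.Eventually.of_forall (norm_le_seminorm ℂ (fourierS n u)))
  · change toTemperedDistributionCLM (Rn n) ℂ volume u (fourierS n φ) = _
    exact (toTemperedDistributionCLM_apply_apply volume u (fourierS n φ)).trans
      (integral_fourierS_mul φ u)

theorem memLp_weighted_schwartz (M : Fin n → ℕ) (t : ℝ) {p : ℝ≥0∞} (hp : 1 ≤ p)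
    (u : 𝓢(Rn n, ℂ)) : MemLp (weighted M t u) p := by
  obtain ⟨N, C, hC, hw⟩ := exists_weight_rpow_le M t
  set k := N + (n + 1) with hk
  set S := 2 ^ k * (Finset.Iic (k, 0)).sup (schwartzSeminormFamily ℂ (Rn n) ℂ) u with hS
  refine (memLp_one_add_norm_rpow_neg (Nat.lt_succ_self n) hp).of_le_mul (c := C * S)
    (aestronglyMeasurable_weighted t u.continuous.aestronglyMeasurable)
    (Filter.Eventually.of_forall fun ξ => ?_)
  rw [norm_weighted, Real.norm_of_nonneg (by positivity)]
  have h1 : (1 + ‖ξ‖) ^ N * ‖u ξ‖ ≤ S * (1 + ‖ξ‖) ^ (-((n + 1 : ℕ) : ℝ)) := by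
    have := one_add_norm_pow_mul_le_seminorm u k ξ
    rw [Real.rpow_neg (by positivity), Real.rpow_natCast, ← div_eq_mul_inv,
      le_div_iff₀ (by positivity)]
    refine le_trans (le_of_eq ?_) this
    rw [hk, pow_add]; ring
  calc weight M ξ ^ t * ‖u ξ‖ ≤ C * (1 + ‖ξ‖) ^ N * ‖u ξ‖ := by gcongr; exact hw ξ
    _ = C * ((1 + ‖ξ‖) ^ N * ‖u ξ‖) := by ring
    _ ≤ C * (S * (1 + ‖ξ‖) ^ (-((n + 1 : ℕ) : ℝ))) := by gcongr
    _ = _ := by ring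

/-! ### The operator on the Fourier side -/

/-- The kernel of `a(x,D)` on the Fourier side. -/
noncomputable def fourierKernel (a : Rn n × Rn n → ℂ) (η ξ : Rn n) : ℂ :=
  ((2 * Real.pi : ℝ) : ℂ)⁻¹ ^ n * fourierX a (η - ξ) ξ

theorem stronglyMeasurable_fourierKernel {a : Rn n × Rn n → ℂ} (ha : Continuous a) :
    StronglyMeasurable fun z : Rn n × Rn n => fourierKernel a z.1 z.2 := by
  have h : Measurable fun z : Rn n × Rn n => (z.1 - z.2, z.2) :=
    measurable_sub.prodMk measurable_snd
  exact ((stronglyMeasurable_fourierX ha).comp_measurable h).const_mul _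

theorem norm_fourierKernel (a : Rn n × Rn n → ℂ) (η ξ : Rn n) :
    ‖fourierKernel a η ξ‖ = (2 * Real.pi)⁻¹ ^ n * ‖fourierX a (η - ξ) ξ‖ := by
  rw [fourierKernel, norm_mul, norm_pow, norm_inv, Complex.norm_real,
    Real.norm_of_nonneg (by positivity)]

theorem psdo_eq (a : Rn n × Rn n → ℂ) (u : 𝓢(Rn n, ℂ)) (x : Rn n) :
    psdo a u x = ((2 * Real.pi : ℝ) : ℂ)⁻¹ ^ n * ∫ ξ, wave (-ξ) x * a (x, ξ) * fourierS n u ξ := by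
  simp [psdo, wave]

variable {a : Rn n × Rn n → ℂ} {m δ κ : ℝ}

/-- Justifies every use of Fubini below: `x` is confined to a compact set, the rapid decay of `û`
absorbs the growth `weight ^ m` in `ξ`, and `φ` is integrable in `η`. -/
theorem integrable_psdo_kernel (hκ : 0 < κ) (ha : IsSymbol M m δ κ a) (hloc : IsLocalized a)
    (u φ : 𝓢(Rn n, ℂ)) : Integrable (fun q : Rn n × (Rn n × Rn n) =>
      wave (-q.2.1) q.1 * a (q.1, q.2.1) * fourierS n u q.2.1 * (wave q.2.2 q.1 * φ q.2.2))
      (volume.prod (volume.prod volume)) := by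
  obtain ⟨K, hK, hsupp⟩ := hloc
  obtain ⟨C, hC, h⟩ := ha.bound_of_ne 0 0 (by rw [mOrder_zero]; exact hκ.ne)
  simp only [derivXi, derivX, multiDeriv_zero, mOrder_zero, sub_zero, zero_sub] at h
  rw [max_eq_right (by linarith), mul_zero, add_zero] at h
  have hu : Integrable (weighted M m (fourierS n u)) :=
    memLp_one_iff_integrable.1 (memLp_weighted_schwartz M m le_rfl _)
  have hKi : Integrable (K.indicator fun _ => C) :=
    (integrable_indicator_iff hK.measurableSet).2 (integrableOn_const hK.measure_lt_top.ne)
  refine (hKi.mul_prod (hu.norm.mul_prod φ.integrable.norm)).mono'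
    (Continuous.aestronglyMeasurable ?_) (Filter.Eventually.of_forall fun q => ?_)
  · refine ((Continuous.mul ?_ ?_).mul ?_).mul (Continuous.mul ?_ ?_)
    · exact continuous_wave.comp (by fun_prop : Continuous fun q : Rn n × (Rn n × Rn n) =>
        (-q.2.1, q.1))
    · exact ha.smooth.continuous.comp (by fun_prop)
    · exact (fourierS n u).continuous.comp (by fun_prop)
    · exact continuous_wave.comp (by fun_prop : Continuous fun q : Rn n × (Rn n × Rn n) =>
        (q.2.2, q.1))
    · exact φ.continuous.comp (by fun_prop)
  · simp only [norm_mul, norm_wave, one_mul, norm_weighted]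
    by_cases hx : q.1 ∈ K
    · rw [Set.indicator_of_mem hx]
      calc _ ≤ C * weight M q.2.1 ^ m * ‖fourierS n u q.2.1‖ * ‖φ q.2.2‖ := by
            gcongr; exact h _ _
        _ = _ := by ring
    · have : a (q.1, q.2.1) = 0 :=
        image_eq_zero_of_notMem_tsupport (f := fun x => a (x, q.2.1)) fun h => hx (hsupp _ h)
      rw [this, Set.indicator_of_notMem hx]
      simp

theorem psdo_mul_fourierS (a : Rn n × Rn n → ℂ) (u φ : 𝓢(Rn n, ℂ)) (x : Rn n) :
    psdo a u x * fourierS n φ x = ((2 * Real.pi : ℝ) : ℂ)⁻¹ ^ n * ∫ z : Rn n × Rn n,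
      wave (-z.1) x * a (x, z.1) * fourierS n u z.1 * (wave z.2 x * φ z.2)
        ∂(volume.prod volume) := by
  rw [integral_prod_mul (fun ξ => wave (-ξ) x * a (x, ξ) * fourierS n u ξ)
    (fun η => wave η x * φ η), psdo_eq, fourierS_eq_integral_wave, mul_assoc]
  simp only [wave_comm x]

theorem integrable_psdo_mul_fourierS (hκ : 0 < κ) (ha : IsSymbol M m δ κ a)
    (hloc : IsLocalized a) (u φ : 𝓢(Rn n, ℂ)) :
    Integrable fun x => psdo a u x * fourierS n φ x := by
  simp only [psdo_mul_fourierS]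
  exact (integrable_psdo_kernel hκ ha hloc u φ).integral_prod_left.const_mul _

/-- Integrating in `x` first merges the two waves into frequency `η - ξ`, which produces `fourierX a
(η - ξ) ξ`. -/
theorem integral_psdo_mul_fourierS (hκ : 0 < κ) (ha : IsSymbol M m δ κ a)
    (hloc : IsLocalized a) (u φ : 𝓢(Rn n, ℂ)) :
    ∫ x, psdo a u x * fourierS n φ x =
      ∫ η, (∫ ξ, fourierKernel a η ξ * fourierS n u ξ) * φ η := by
  have hint := integrable_psdo_kernel hκ ha hloc u φ
  have hx : ∀ z : Rn n × Rn n, ∫ x, wave (-z.1) x * a (x, z.1) * fourierS n u z.1 *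
      (wave z.2 x * φ z.2) = fourierX a (z.2 - z.1) z.1 * fourierS n u z.1 * φ z.2 := fun z => by
    rw [fourierX, ← integral_mul_const, ← integral_mul_const]
    refine integral_congr_ae (Filter.Eventually.of_forall fun x => ?_)
    simp only
    rw [← wave_mul_wave_neg]
    ring
  have hz : Integrable (fun z : Rn n × Rn n =>
      fourierX a (z.2 - z.1) z.1 * fourierS n u z.1 * φ z.2) (volume.prod volume) := by
    simpa only [hx] using hint.integral_prod_right
  simp only [psdo_mul_fourierS]
  rw [integral_const_mul, integral_integral_swap hint]
  simp only [hx]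
  rw [integral_prod_symm _ hz, ← integral_const_mul]
  refine integral_congr_ae (Filter.Eventually.of_forall fun η => ?_)
  simp only [fourierKernel]
  rw [← integral_const_mul, ← integral_mul_const]
  refine integral_congr_ae (Filter.Eventually.of_forall fun ξ => ?_)
  simp only
  ring

theorem aestronglyMeasurable_psdo (ha : Continuous a) (u : 𝓢(Rn n, ℂ)) :
    AEStronglyMeasurable (psdo a u) volume := by
  have h : Continuous fun z : Rn n × Rn n => wave (-z.2) z.1 * a z * fourierS n u z.2 := by
    refine (Continuous.mul ?_ ha).mul ((fourierS n u).continuous.comp continuous_snd)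
    exact continuous_wave.comp (by fun_prop : Continuous fun z : Rn n × Rn n => (-z.2, z.1))
  have h2 := (h.stronglyMeasurable.integral_prod_right' (ν := volume)).const_mul
    (((2 * Real.pi : ℝ) : ℂ)⁻¹ ^ n)
  refine h2.aestronglyMeasurable.congr (Filter.Eventually.of_forall fun x => ?_)
  exact (psdo_eq a u x).symm

/-- `a(x,D)u` is the distribution whose Fourier transform is given by `fourierKernel`. -/
theorem isFunction_fourierInvD_psdo (hκ : 0 < κ) (ha : IsSymbol M m δ κ a) (hloc : IsLocalized a)
    (u : 𝓢(Rn n, ℂ)) {H : 𝓢'(Rn n, ℂ)}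
    (hH : IsFunction H fun η => ∫ ξ, fourierKernel a η ξ * fourierS n u ξ) :
    IsFunction (fourierInvD H) (psdo a u) := by
  refine ⟨aestronglyMeasurable_psdo ha.smooth.continuous u, fun φ => ?_⟩
  have h1 := integrable_psdo_mul_fourierS hκ ha hloc u (fourierInvS n φ)
  have h2 := integral_psdo_mul_fourierS hκ ha hloc u (fourierInvS n φ)
  rw [fourierS_fourierInvS] at h1 h2
  exact ⟨h1, by rw [h2, fourierInvD_apply, (hH.2 _).2]⟩

/-! ### Convolution bound for the kernel and construction of the extension -/

theorem exists_fourierKernel_bound (hn : 1 ≤ n) (hM : ∀ j, 0 < M j) (hδ₀ : 0 ≤ δ) (hδ₁ : δ ≤ 1)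
    (hκ : (⌊(n : ℝ) / (minOrder M : ℝ)⌋ : ℝ) + 1 < κ) (ha : IsSymbol M m δ κ a)
    (hloc : IsLocalized a) {s : ℝ} (hs : δ < 1 ∨ 0 ≤ s) : ∃ (L : ℕ) (C : ℝ), n < L ∧ ∀ η ξ,
      weight M η ^ s * ‖fourierKernel a η ξ‖ ≤
        C * ((1 + ‖η - ξ‖) ^ (-(L : ℝ)) * weight M ξ ^ (s + m)) := by
  have hμ : (0 : ℝ) < minOrder M := by exact_mod_cast minOrder_pos hn hM
  have hq : (0 : ℝ) ≤ n / minOrder M := by positivity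
  -- The least natural number with `N > n / μ_*`; the hypothesis on `κ` says exactly `N < κ`.
  set N := ⌊(n : ℝ) / (minOrder M : ℝ)⌋₊ + 1 with hNdef
  have hNκ : (N : ℝ) < κ := by
    rw [hNdef]
    push_cast
    rwa [natCast_floor_eq_intCast_floor hq]
  have hNn : n < minOrder M * N := by
    have h := Nat.lt_floor_add_one ((n : ℝ) / (minOrder M : ℝ))
    rw [div_lt_iff₀ hμ] at h
    have : (n : ℝ) < N * minOrder M := by rw [hNdef]; push_cast; exact h
    rw [mul_comm]
    exact_mod_cast this
  have hκ0 : 0 < κ := lt_of_le_of_lt (Nat.cast_nonneg N) hNκ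
  obtain ⟨C₁, hC₁, h₁⟩ := exists_kernel_bound (M := M) (s := s) hδ₁ hδ₀ hNκ hs
    (A := fun ζ ξ => ‖fourierX a ζ ξ‖) (fun _ _ => norm_nonneg _)
    (fun k hk => ha.exists_fourierX_bound hM hδ₀ hκ0 hloc k hk)
  obtain ⟨C₂, hC₂, h₂⟩ := exists_weight_rpow_neg_le M N
  refine ⟨minOrder M * N, (2 * Real.pi)⁻¹ ^ n * (C₁ * C₂), hNn, fun η ξ => ?_⟩
  have hw : 0 ≤ weight M ξ ^ (s + m) := Real.rpow_nonneg (weight_pos ξ).le _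
  rw [norm_fourierKernel]
  calc _ = (2 * Real.pi)⁻¹ ^ n * (weight M η ^ s * ‖fourierX a (η - ξ) ξ‖) := by ring
    _ ≤ (2 * Real.pi)⁻¹ ^ n * (C₁ * ((C₂ * (1 + ‖η - ξ‖) ^ (-((minOrder M * N : ℕ) : ℝ))) *
          weight M ξ ^ (s + m))) := by
        refine mul_le_mul_of_nonneg_left ((h₁ η ξ).trans ?_) (by positivity)
        gcongr
        exact h₂ _
    _ = _ := by ring

/-- The operator sends `v` to the inverse transform of `op v̂`. A representative of `v̂` is chosen
arbitrarily; linearity survives because `op` ignores null sets and a distribution is determined by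
its representing function. -/
theorem extendsBoundedly (hn : 1 ≤ n) (hM : ∀ j, 0 < M j) (hδ₀ : 0 ≤ δ) (hδ₁ : δ ≤ 1)
    (hκ : (⌊(n : ℝ) / (minOrder M : ℝ)⌋ : ℝ) + 1 < κ) (ha : IsSymbol M m δ κ a)
    (hloc : IsLocalized a) {p : ℝ≥0∞} (hp : 1 ≤ p) {s : ℝ} (hs : δ < 1 ∨ 0 ≤ s) :
    ExtendsBoundedly a M p (s + m) s := by
  obtain ⟨L, C, hL, hb⟩ := exists_fourierKernel_bound hn hM hδ₀ hδ₁ hκ ha hloc hs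
  have hκ0 : 0 < κ := by
    have : (0 : ℝ) ≤ ⌊(n : ℝ) / (minOrder M : ℝ)⌋ := by
      exact_mod_cast Int.floor_nonneg.2 (by positivity)
    linarith
  have hKm := stronglyMeasurable_fourierKernel ha.smooth.continuous
  set I := ∫⁻ ζ : Rn n, ENNReal.ofReal (C * (1 + ‖ζ‖) ^ (-(L : ℝ))) with hI
  have hIfin : I ≠ ⊤ := ((memLp_one_iff_integrable.1
    (memLp_one_add_norm_rpow_neg hL le_rfl)).const_mul C).lintegral_lt_top.ne
  let op : (Rn n → ℂ) → Rn n → ℂ := fun g η => ∫ ξ, fourierKernel a η ξ * g ξ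
  have hop_congr : ∀ {g h : Rn n → ℂ}, g =ᵐ[volume] h → op g = op h := fun {g h} hgh => by
    funext η
    refine integral_congr_ae ?_
    filter_upwards [hgh] with ξ hξ
    rw [hξ]
  choose g hg hgp using fun v : FL M p (s + m) => v.2
  have hle : ∀ v, eLpNorm (weighted M s (op (g v))) p volume ≤
      I * eLpNorm (weighted M (s + m) (g v)) p volume := fun v =>
    eLpNorm_integral_kernel_mul_le hp hb (hg v).1
  have hopm : ∀ v, AEStronglyMeasurable (op (g v)) := fun v =>
    aestronglyMeasurable_integral_kernel_mul hKm (hg v).1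
  have hopp : ∀ v, MemLp (weighted M s (op (g v))) p := fun v =>
    ⟨aestronglyMeasurable_weighted s (hopm v),
      (hle v).trans_lt (ENNReal.mul_lt_top hIfin.lt_top (hgp v).2)⟩
  choose H hH using fun v => exists_isFunction hp (hopm v) (hopp v)
  have hT : ∀ v, IsFunction (fourierD (fourierInvD (H v))) (op (g v)) := fun v => by
    rw [fourierD_fourierInvD]; exact hH v
  have hadd : ∀ v w, H (v + w) = H v + H w := fun v w => by
    have e : op (g (v + w)) = op (g v) + op (g w) := by
      rw [hop_congr ((hg (v + w)).ae_eq ((hg v).add (hg w)))]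
      funext η
      rw [Pi.add_apply, ← integral_add
        (integrable_kernel_mul hL hp hKm hb (hg v).1 (hgp v) η)
        (integrable_kernel_mul hL hp hKm hb (hg w).1 (hgp w) η)]
      simp only [op, Pi.add_apply, mul_add]
    exact (hH (v + w)).unique (e ▸ (hH v).add (hH w))
  have hsmul : ∀ (c : ℂ) v, H (c • v) = c • H v := fun c v => by
    have e : op (g (c • v)) = c • op (g v) := by
      rw [hop_congr ((hg (c • v)).ae_eq ((hg v).const_smul c))]
      funext η
      rw [Pi.smul_apply, smul_eq_mul, ← integral_const_mul]
      simp only [op, Pi.smul_apply, smul_eq_mul, mul_left_comm]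
    exact (hH (c • v)).unique (e ▸ (hH v).const_smul c)
  refine ⟨{ toFun := fun v => ⟨fourierInvD (H v), op (g v), hT v, hopp v⟩
            map_add' := fun v w => Subtype.ext ?_
            map_smul' := fun c v => Subtype.ext ?_ }, ⟨I.toNNReal, fun v => ?_⟩, fun u => ?_⟩
  · simp only [hadd]
    exact map_add (PointwiseConvergenceCLM.precomp ℂ (fourierInvS n)) _ _
  · simp only [hsmul]
    exact map_smul (PointwiseConvergenceCLM.precomp ℂ (fourierInvS n)) _ _
  · rw [ENNReal.coe_toNNReal hIfin, flNorm_eq M p (s + m) (hg v)]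
    exact (flNorm_eq M p s (hT v)).trans_le (hle v)
  · have hu := isFunction_fourierD_toTemperedDistributionCLM u
    have hmem : toTemperedDistributionCLM (Rn n) ℂ volume u ∈ FL M p (s + m) :=
      ⟨fourierS n u, hu, memLp_weighted_schwartz M (s + m) hp _⟩
    have hHu := hH ⟨_, hmem⟩
    -- The chosen representative may be replaced by the classical transform `fourierS n u`.
    rw [hop_congr ((hg ⟨_, hmem⟩).ae_eq hu)] at hHu
    exact ⟨hmem, isFunction_fourierInvD_psdo hκ0 ha hloc u hHu⟩

end FourierLebesgue

theorem mainTheorem2 {n : ℕ} (hn : 1 ≤ n) (M : Fin n → ℕ) (hM : ∀ j, 0 < M j)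
    (m δ κ : ℝ) (hδ₀ : 0 ≤ δ) (hδ₁ : δ ≤ 1)
    (hκ : (⌊(n : ℝ) / (FourierLebesgue.minOrder M : ℝ)⌋ : ℝ) + 1 < κ)
    (a : FourierLebesgue.Rn n × FourierLebesgue.Rn n → ℂ)
    (ha : FourierLebesgue.IsSymbol M m δ κ a) (hloc : FourierLebesgue.IsLocalized a)
    (p : ℝ≥0∞) (hp : 1 ≤ p) :
    (δ < 1 → ∀ s : ℝ, FourierLebesgue.ExtendsBoundedly a M p (s + m) s) ∧
      (δ = 1 → ∀ s : ℝ, 0 < s → FourierLebesgue.ExtendsBoundedly a M p (s + m) s) :=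
  ⟨fun hδ _ => FourierLebesgue.extendsBoundedly hn hM hδ₀ hδ₁ hκ ha hloc hp (Or.inl hδ),
    fun _ _ hs => FourierLebesgue.extendsBoundedly hn hM hδ₀ hδ₁ hκ ha hloc hp (Or.inr hs.le)⟩
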